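/- Let $G$ be a connected real semisimple Lie group with finite center, with Lie algebra $\mathfrak g$ and Killing form $B$. Let $\mathfrak g=\mathfrak k\oplus\mathfrak p$ be a Cartan decomposition and let $K$ be a maximal compact subgroup of $G$ with Lie algebra $\mathfrak k$. Equip $\mathfrak g$ with the $K$-invariant Euclidean norm $\|X_1+X_2\|^2=-B(X_1,X_1)+B(X_2,X_2)$ for $X_1\in\mathfrak k$, $X_2\in\mathfrak p$, and write $g\cdot X$ for the adjoint action. The Killing form identifies $\mathfrak g^*$ with $\mathfrak g$, so that coadjoint orbits of $G$ become adjoint orbits. Let $\lambda\in\mathfrak k$ be regular, i.e. its stabilizer $G_\lambda$ in $G$ is a maximal torus of $K$, and let $M=G\cdot\lambda\subset\mathfrak g$ be its (regular elliptic) orbit. Let $\Phi:M\to\mathfrak k$ be the restriction to $M$ of the projection $\mathfrak g=\mathfrak k\oplus\mathfrak p\to\mathfrak k$; it is the moment map of the $K$-action on $M$. For $\mu\in\mathfrak k$ and $t\in\mathbb R$ let $\Phi_{t\mu}:M\times K\cdot\mu\to\mathfrak k$, $\Phi_{t\mu}(m,n)=\Phi(m)-t\,n$, with $\Phi_\mu=\Phi_{1\mu}$,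 and let $\mathrm{Cr}(\|\Phi_{t\mu}\|^2)\subset M\times K\cdot\mu$ be the set of critical points of the function $\|\Phi_{t\mu}\|^2:M\times K\cdot\mu\to\mathbb R$. Then: 1. For every $\mu\in\mathfrak k$, the set $\mathrm{Cr}(\|\Phi_\mu\|^2)$ is a compact subset of $M\times K\cdot\mu$. 2. For every $r\ge 0$ there exists $c(r)>0$ such that for every $\mu\in\mathfrak k$ with $\|\mu\|\le r$, $$\mathrm{Cr}(\|\Phi_\mu\|^2)\subset\bigl(M\cap\{\xi\in\mathfrak g:\ \|\xi\|\le c(r)\}\bigr)\times K\cdot\mu .$$ 3. For every $\mu\in\mathfrak k$ there exists a compact subset $\mathcal K\subset M$ such that for every $t\in[0,1]$ the critical set $\mathrm{Cr}(\|\Phi_{t\mu}\|^2)$ is contained in $\mathcal K\times K\cdot\mu$. -/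

import Mathlib

open scoped Manifold ContDiff

namespace AdjointOrbit

/-! ### Critical points of a function on a submanifold -/

/-- The critical points of a function `f : S → ℝ` on an embedded submanifold `S` of a topological
vector space: the points `p` such that `f` has derivative zero at `p` along every curve in `S` that
passes through `p` at time `0` and is differentiable there. -/
def criticalSet {V : Type*} [AddCommGroup V] [Module ℝ V] [TopologicalSpace V]
    {S : Set V} (f : S → ℝ) : Set S :=
  {p | ∀ c : ℝ → S, c 0 = p → DifferentiableAt ℝ (fun t => (c t : V)) 0 →
    HasDerivAt (fun t => f (c t)) 0 0}

/-! ### Lie groups: adjoint action, Lie algebra of a subgroup, maximal compacts and tori -/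

section Group

variable {E : Type*} [NormedAddCommGroup E] [NormedSpace ℝ E]
  {G : Type*} [TopologicalSpace G] [ChartedSpace E G] [Group G]

/-- The adjoint action `Ad g : 𝔤 → 𝔤`, the derivative at `1` of the conjugation `x ↦ g x g⁻¹`. -/
noncomputable def Ad (g : G) (X : GroupLieAlgebra 𝓘(ℝ, E) G) : GroupLieAlgebra 𝓘(ℝ, E) G :=
  mfderiv 𝓘(ℝ, E) 𝓘(ℝ, E) (fun x : G => g * x * g⁻¹) 1 X

/-- The orbit `K · X` of `X` in the Lie algebra under the adjoint action of a subgroup `K`. -/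
def orbit (K : Subgroup G) (X : GroupLieAlgebra 𝓘(ℝ, E) G) : Set (GroupLieAlgebra 𝓘(ℝ, E) G) :=
  {Y | ∃ g ∈ K, Ad g X = Y}

/-- The stabilizer `G_X` of `X` for the adjoint action. -/
def stab (X : GroupLieAlgebra 𝓘(ℝ, E) G) : Set G :=
  {g | Ad g X = X}

variable (E) in
/-- The Lie algebra of a closed subgroup `K`, as a subset of the Lie algebra of `G`: the velocities
at `1` of the curves in `K`. -/
def lieAlgebraOf (K : Subgroup G) : Set (GroupLieAlgebra 𝓘(ℝ, E) G) :=
  {X | ∃ c : ℝ → G, (∀ t, c t ∈ K) ∧ c 0 = 1 ∧ MDifferentiableAt 𝓘(ℝ, ℝ) 𝓘(ℝ, E) c 0 ∧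
    (mfderiv 𝓘(ℝ, ℝ) 𝓘(ℝ, E) c 0 (1 : ℝ) : E) = X}

/-- `K` is a maximal compact subgroup of `G`. -/
def IsMaximalCompact (K : Subgroup G) : Prop :=
  Maximal (fun H : Subgroup G => IsCompact (H : Set G)) K

/-- A torus in a Lie group: a compact connected abelian subgroup. -/
def IsTorus (T : Subgroup G) : Prop :=
  IsCompact (T : Set G) ∧ IsConnected (T : Set G) ∧ ∀ x ∈ T, ∀ y ∈ T, x * y = y * x

/-- `T` is a maximal torus in `K`. -/
def IsMaximalTorus (K T : Subgroup G) : Prop :=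
  Maximal (fun H : Subgroup G => H ≤ K ∧ IsTorus H) T

/-- `X` is regular elliptic (with respect to `K`): its stabilizer in `G` is a maximal torus
of `K` (so that it is also the stabilizer of `X` in `K`). -/
def IsRegularElliptic (K : Subgroup G) (X : GroupLieAlgebra 𝓘(ℝ, E) G) : Prop :=
  ∃ T : Subgroup G, IsMaximalTorus K T ∧ stab X = (T : Set G)

end Group

/-! ### Smooth Lie groups have the regularity that Mathlib's Lie bracket asks for -/

section Smooth

variable {E : Type*} [NormedAddCommGroup E] [NormedSpace ℝ E]
  {G : Type*} [TopologicalSpace G] [ChartedSpace E G] [Group G]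

instance instLieGroupMinSmoothness [LieGroup 𝓘(ℝ, E) ∞ G] :
    LieGroup 𝓘(ℝ, E) (minSmoothness ℝ 3) G :=
  LieGroup.of_le (n := ∞) (by
    rw [minSmoothness_of_isRCLikeNormedField]
    exact (inferInstance : ENat.LEInfty 3).out)

end Smooth

/-! ### Cartan decompositions and the associated Euclidean norm -/

section Cartan

variable {L : Type*} [LieRing L] [LieAlgebra ℝ L]

/-- `L = 𝔨 ⊕ 𝔭` is a Cartan decomposition of the real Lie algebra `L`. -/
structure IsCartanDecomposition (𝔨 𝔭 : Submodule ℝ L) : Prop where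
  isCompl : IsCompl 𝔨 𝔭
  lie_kk : ∀ X ∈ 𝔨, ∀ Y ∈ 𝔨, ⁅X, Y⁆ ∈ 𝔨
  lie_kp : ∀ X ∈ 𝔨, ∀ Y ∈ 𝔭, ⁅X, Y⁆ ∈ 𝔭
  lie_pp : ∀ X ∈ 𝔭, ∀ Y ∈ 𝔭, ⁅X, Y⁆ ∈ 𝔨
  neg_def : ∀ X ∈ 𝔨, X ≠ 0 → killingForm ℝ L X X < 0
  pos_def : ∀ X ∈ 𝔭, X ≠ 0 → 0 < killingForm ℝ L X X

variable {𝔨 𝔭 : Submodule ℝ L}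

/-- The projection of `L = 𝔨 ⊕ 𝔭` onto `𝔨`, with kernel `𝔭`. -/
noncomputable def projK (h : IsCartanDecomposition 𝔨 𝔭) : L →ₗ[ℝ] L :=
  𝔨.projection 𝔭 h.isCompl

/-- The projection of `L = 𝔨 ⊕ 𝔭` onto `𝔭`, with kernel `𝔨`. -/
noncomputable def projP (h : IsCartanDecomposition 𝔨 𝔭) : L →ₗ[ℝ] L :=
  𝔭.projection 𝔨 h.isCompl.symm

/-- The Euclidean norm on `L` given by `‖X₁ + X₂‖² = -B(X₁, X₁) + B(X₂, X₂)` for `X₁ ∈ 𝔨` and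
`X₂ ∈ 𝔭`, where `B` is the Killing form. -/
noncomputable def cartanNorm (h : IsCartanDecomposition 𝔨 𝔭) (X : L) : ℝ :=
  Real.sqrt (-killingForm ℝ L (projK h X) (projK h X) + killingForm ℝ L (projP h X) (projP h X))

end Cartan

/-! ### The moment map on `G·lam × K·μ` -/

section Moment

variable {E : Type*} [NormedAddCommGroup E] [NormedSpace ℝ E] [CompleteSpace E]
  {G : Type*} [TopologicalSpace G] [ChartedSpace E G] [Group G] [LieGroup 𝓘(ℝ, E) ∞ G]
  {𝔨 𝔭 : Submodule ℝ (GroupLieAlgebra 𝓘(ℝ, E) G)}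

/-- The function `‖Φ_{tμ}‖²` on `G·lam × K·μ`, where `Φ_{tμ}(m, n) = Φ(m) - t n` and
the moment map `Φ` is the restriction to `G·lam` of the projection onto `𝔨`. -/
noncomputable def momentNormSq (h : IsCartanDecomposition 𝔨 𝔭) (K : Subgroup G)
    (lam μ : GroupLieAlgebra 𝓘(ℝ, E) G) (t : ℝ)
    (x : (orbit (⊤ : Subgroup G) lam ×ˢ orbit K μ :
      Set (GroupLieAlgebra 𝓘(ℝ, E) G × GroupLieAlgebra 𝓘(ℝ, E) G))) : ℝ :=
  cartanNorm h (projK h x.1.1 - t • x.1.2) ^ 2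

/-- The critical set of `‖Φ_{tμ}‖²` on `G·lam × K·μ`. -/
noncomputable def momentCr (h : IsCartanDecomposition 𝔨 𝔭) (K : Subgroup G)
    (lam μ : GroupLieAlgebra 𝓘(ℝ, E) G) (t : ℝ) :
    Set (orbit (⊤ : Subgroup G) lam ×ˢ orbit K μ :
      Set (GroupLieAlgebra 𝓘(ℝ, E) G × GroupLieAlgebra 𝓘(ℝ, E) G)) :=
  criticalSet (momentNormSq h K lam μ t)

/-- There is a compact subset of `G·lam` such that for every `t ∈ [0, 1]` the critical set of
`‖Φ_{tμ}‖²` on `G·lam × K·μ` is contained in the product of this compact subset and `K·μ`. -/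
def CompactCrAssumption (h : IsCartanDecomposition 𝔨 𝔭) (K : Subgroup G)
    (lam μ : GroupLieAlgebra 𝓘(ℝ, E) G) : Prop :=
  ∃ C ⊆ orbit (⊤ : Subgroup G) lam, IsCompact C ∧ ∀ t ∈ Set.Icc (0 : ℝ) 1,
    Subtype.val '' momentCr h K lam μ t ⊆ C ×ˢ orbit K μ

end Moment

end AdjointOrbit

/-! Write a = Φ(m) - t n. Along a curve in M × K·μ with velocity (v, w), the derivative of ‖Φ_{tμ}‖²
is 2(t B(a, w) - B(a, v)). Moving m in all directions [X, m] and using nondegeneracy of B gives [a,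
m] = 0; moving n in the direction [[a, n], n] gives t B([a, n], [a, n]) = 0, hence t [a, n] = 0
because B is definite on 𝔨 (`bracketE_eq_zero_of_mem_momentCr`).

The bound uses regularity. If m = g·λ and [a, m] = 0, then a' = g⁻¹·a centralizes λ, so it lies in
Lie(G_λ) ⊂ 𝔨. Invariance of B gives ⟨Φ(m), a⟩ = ⟨λ, a'⟩ with ‖a'‖ = ‖a‖, while Φ(m) - a = t n has
norm |t|‖μ‖. Cauchy-Schwarz yields ‖Φ(m)‖² ≤ ‖λ‖² + t²‖μ‖², and since ‖m‖² = 2‖Φ(m)‖² + B(m, m) with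
B(m, m) = -‖λ‖², it follows that ‖m‖² ≤ ‖λ‖² + 2t²‖μ‖² (`inner_le_of_mem_momentCr`). This is uniform
in μ and t on bounded sets.

Compactness needs two more facts. M is closed (`isClosed_orbit_AdL`): ad λ is skew for the Euclidean
product, so it is a root of a separable polynomial f, and near a root of f(ad ·) = 0 every other
root is conjugate to it. The equations [a, m] = [a, n] = 0 also suffice for criticality
(`mem_momentCr_of_bracketE_eq_zero`): along a curve of roots of f, the velocity is B-orthogonal to
the centralizer of the base point (`killE_velocity_eq_zero`), so no manifold structure on the orbits
is needed. -/

namespace AdjointOrbit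

open Filter Topology VectorField

/-! ### Second-order calculus of a local group law. -/

section LocalGroup

variable {E : Type*} [NormedAddCommGroup E] [NormedSpace ℝ E]

/-- For a local group law `m` with conjugation `c`, the derivative at the identity of the adjoint
action is the bracket of left invariant vector fields. -/
theorem fderiv_conjugation_eq {m c : E × E → E} {e : E}
    (hm : ContDiffAt ℝ 2 m (e, e)) (hc : ContDiffAt ℝ 2 c (e, e))
    (hm1 : ∀ᶠ x in 𝓝 e, m (x, e) = x)
    (hc1 : ∀ᶠ x in 𝓝 e, c (x, e) = e) (hc2 : ∀ᶠ y in 𝓝 e, c (e, y) = y)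
    (hmc : ∀ᶠ p in 𝓝 (e, e), m (c p, p.1) = m p) (X Y : E) :
    fderiv ℝ (fun x => fderiv ℝ c (x, e) (0, Y)) e X =
      fderiv ℝ (fun x => fderiv ℝ m (x, e) (0, Y)) e X -
        fderiv ℝ (fun x => fderiv ℝ m (x, e) (0, X)) e Y := by
  have hcee : c (e, e) = e := hc1.self_of_nhds
  have hDm : DifferentiableAt ℝ (fderiv ℝ m) (e, e) :=
    (hm.fderiv_right (m := 1) (by norm_num)).differentiableAt (by norm_num)
  have hDc : DifferentiableAt ℝ (fderiv ℝ c) (e, e) :=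
    (hc.fderiv_right (m := 1) (by norm_num)).differentiableAt (by norm_num)
  have hsymm : IsSymmSndFDerivAt ℝ m (e, e) := hm.isSymmSndFDerivAt (by simp)
  have hl : HasFDerivAt (fun x : E => (x, e)) (ContinuousLinearMap.inl ℝ E E) e :=
    hasFDerivAt_prodMk_left e e
  have hr : HasFDerivAt (fun x : E => (e, x)) (ContinuousLinearMap.inr ℝ E E) e :=
    hasFDerivAt_prodMk_right e e
  have hML : HasFDerivAt (fun x => fderiv ℝ m (x, e))
      ((fderiv ℝ (fderiv ℝ m) (e, e)).comp (ContinuousLinearMap.inl ℝ E E)) e :=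
    HasFDerivAt.comp e (f := fun x : E => (x, e)) hDm.hasFDerivAt hl
  have hMR : HasFDerivAt (fun x => fderiv ℝ m (e, x))
      ((fderiv ℝ (fderiv ℝ m) (e, e)).comp (ContinuousLinearMap.inr ℝ E E)) e :=
    HasFDerivAt.comp e (f := fun x : E => (e, x)) hDm.hasFDerivAt hr
  have hCL : HasFDerivAt (fun x => fderiv ℝ c (x, e))
      ((fderiv ℝ (fderiv ℝ c) (e, e)).comp (ContinuousLinearMap.inl ℝ E E)) e :=
    HasFDerivAt.comp e (f := fun x : E => (x, e)) hDc.hasFDerivAt hl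
  have hML' : ∀ Z W : E, fderiv ℝ (fun x => fderiv ℝ m (x, e) (0, Z)) e W =
      fderiv ℝ (fderiv ℝ m) (e, e) (W, 0) (0, Z) := by
    intro Z W
    rw [(hML.clm_apply (hasFDerivAt_const _ _)).fderiv]
    simp
  have hm_diff : ∀ᶠ p in 𝓝 (e, e), DifferentiableAt ℝ m p := by
    filter_upwards [hm.eventually (by simp)] with p hp using hp.differentiableAt (by norm_num)
  have hc_diff : ∀ᶠ p in 𝓝 (e, e), DifferentiableAt ℝ c p := by
    filter_upwards [hc.eventually (by simp)] with p hp using hp.differentiableAt (by norm_num)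
  have htl : Tendsto (fun x : E => (x, e)) (𝓝 e) (𝓝 (e, e)) := hl.continuousAt
  have htr : Tendsto (fun x : E => (e, x)) (𝓝 e) (𝓝 (e, e)) := hr.continuousAt
  -- The y-derivative at e of the identity (x y x⁻¹) x = x y; differentiating it once more, in x
  -- along X, produces the bracket formula.
  have key : ∀ᶠ x in 𝓝 e, fderiv ℝ m (e, x) (fderiv ℝ c (x, e) (0, Y), 0) =
      fderiv ℝ m (x, e) (0, Y) := by
    filter_upwards [htl.eventually hm_diff, htr.eventually hm_diff, htl.eventually hc_diff,
      htl.eventually hmc.eventually_nhds, hc1] with x h1 h2 h3 h4 h5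
    have hx : HasFDerivAt (fun y : E => (x, y)) (ContinuousLinearMap.inr ℝ E E) e :=
      hasFDerivAt_prodMk_right x e
    have hA : HasFDerivAt (fun y => c (x, y))
        ((fderiv ℝ c (x, e)).comp (ContinuousLinearMap.inr ℝ E E)) e :=
      HasFDerivAt.comp e (f := fun y : E => (x, y)) h3.hasFDerivAt hx
    have hB := HasFDerivAt.comp e (g := m) (f := fun y : E => (c (x, y), x)) (g' := fderiv ℝ m (e, x))
      (by simpa [h5] using h2.hasFDerivAt) (hA.prodMk (hasFDerivAt_const x e))
    have hC : HasFDerivAt (fun y => m (x, y))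
        ((fderiv ℝ m (x, e)).comp (ContinuousLinearMap.inr ℝ E E)) e :=
      HasFDerivAt.comp e (f := fun y : E => (x, y)) h1.hasFDerivAt hx
    have heq : (m ∘ fun y : E => (c (x, y), x)) =ᶠ[𝓝 e] fun y => m (x, y) :=
      hx.continuousAt.eventually h4
    have := congrArg (fun T => T Y) ((hB.congr_of_eventuallyEq heq.symm).unique hC)
    simpa using this
  have hC := hCL.clm_apply (hasFDerivAt_const ((0 : E), Y) e)
  have hL := hMR.clm_apply (hC.prodMk (hasFDerivAt_const (0 : E) e))
  have hR := hML.clm_apply (hasFDerivAt_const ((0 : E), Y) e)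
  have hee := congrArg (fun T => T X) ((hL.congr_of_eventuallyEq (EventuallyEq.symm key)).unique hR)
  have hCe : fderiv ℝ c (e, e) (0, Y) = Y := by
    have h1 : HasFDerivAt (fun y => c (e, y))
        ((fderiv ℝ c (e, e)).comp (ContinuousLinearMap.inr ℝ E E)) e :=
      HasFDerivAt.comp e (f := fun y : E => (e, y))
        hc_diff.self_of_nhds.hasFDerivAt hr
    have h2 := congrArg (fun T => T Y)
      (h1.unique ((hasFDerivAt_id e).congr_of_eventuallyEq hc2))
    simpa using h2
  have hMe : ∀ Z : E, fderiv ℝ m (e, e) (Z, 0) = Z := by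
    intro Z
    have h1 : HasFDerivAt (fun y => m (y, e))
        ((fderiv ℝ m (e, e)).comp (ContinuousLinearMap.inl ℝ E E)) e :=
      HasFDerivAt.comp e (f := fun y : E => (y, e))
        hm_diff.self_of_nhds.hasFDerivAt hl
    have h2 := congrArg (fun T => T Z)
      (h1.unique ((hasFDerivAt_id e).congr_of_eventuallyEq hm1))
    simpa using h2
  -- Symmetry of the second derivative of m matches the mixed term from the left side of `key` with
  -- the second term of the bracket.
  rw [hML', hML', hC.fderiv, hsymm.eq (Y, 0) (0, X)]
  simp [hCe, hMe] at hee ⊢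
  rw [← hee]
  abel

end LocalGroup

end AdjointOrbit

namespace AdjointOrbit

open Filter Topology VectorField

/-! ### Multiplication and conjugation in the chart at the identity. -/

section ChartCalculus

variable {E : Type*} [NormedAddCommGroup E] [NormedSpace ℝ E]
  {G : Type*} [TopologicalSpace G] [ChartedSpace E G] [Group G]

variable (E G) in
/-- The preferred chart at the identity. -/
noncomputable abbrev chartOne : PartialEquiv G E := extChartAt 𝓘(ℝ, E) (1 : G)

variable (E G) in
/-- The coordinates of the identity. -/
noncomputable abbrev coordOne : E := chartOne E G 1

variable (E G) in
/-- The multiplication, in the chart at the identity. -/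
noncomputable def chartMul (p : E × E) : E :=
  chartOne E G ((chartOne E G).symm p.1 * (chartOne E G).symm p.2)

variable (E G) in
/-- The conjugation, in the chart at the identity. -/
noncomputable def chartConj (p : E × E) : E :=
  chartOne E G ((chartOne E G).symm p.1 * (chartOne E G).symm p.2 * ((chartOne E G).symm p.1)⁻¹)

theorem chartOne_symm_coordOne : (chartOne E G).symm (coordOne E G) = 1 :=
  extChartAt_to_inv (I := 𝓘(ℝ, E)) (1 : G)

theorem eventually_mem_target : ∀ᶠ x in 𝓝 (coordOne E G), x ∈ (chartOne E G).target :=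
  extChartAt_target_mem_nhds (I := 𝓘(ℝ, E)) (1 : G)

/-- The derivative at the identity of a vector-valued function is computed in the chart. -/
theorem mfderiv_one_eq_fderiv {F : Type*} [NormedAddCommGroup F] [NormedSpace ℝ F] {f : G → F}
    (hf : MDifferentiableAt 𝓘(ℝ, E) 𝓘(ℝ, F) f 1) :
    (mfderiv 𝓘(ℝ, E) 𝓘(ℝ, F) f 1 : E →L[ℝ] F) =
      fderiv ℝ (fun x => f ((chartOne E G).symm x)) (coordOne E G) := by
  simp only [mfderiv, hf, writtenInExtChartAt, extChartAt_model_space_eq_id,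
    PartialEquiv.refl_coe, ModelWithCorners.range_eq_univ, fderivWithin_univ]
  rfl

variable [LieGroup 𝓘(ℝ, E) ∞ G]

theorem contMDiffAt_chartOne_symm :
    ContMDiffAt 𝓘(ℝ, E) 𝓘(ℝ, E) ∞ (chartOne E G).symm (coordOne E G) :=
  (contMDiffOn_extChartAt_symm (1 : G)).contMDiffAt eventually_mem_target

theorem contDiffAt_chartMul :
    ContDiffAt ℝ ∞ (chartMul E G) (coordOne E G, coordOne E G) := by
  rw [← contMDiffAt_iff_contDiffAt]
  have h1 : ContMDiffAt 𝓘(ℝ, E × E) 𝓘(ℝ, E) ∞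
      (fun p : E × E => (chartOne E G).symm p.1) (coordOne E G, coordOne E G) :=
    ContMDiffAt.comp (x := (coordOne E G, coordOne E G)) (f := Prod.fst) (I' := 𝓘(ℝ, E))
      contMDiffAt_chartOne_symm contDiffAt_fst.contMDiffAt
  have h2 : ContMDiffAt 𝓘(ℝ, E × E) 𝓘(ℝ, E) ∞
      (fun p : E × E => (chartOne E G).symm p.2) (coordOne E G, coordOne E G) :=
    ContMDiffAt.comp (x := (coordOne E G, coordOne E G)) (f := Prod.snd) (I' := 𝓘(ℝ, E))
      contMDiffAt_chartOne_symm contDiffAt_snd.contMDiffAt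
  refine ContMDiffAt.comp_of_eq (I' := 𝓘(ℝ, E)) contMDiffAt_extChartAt (h1.mul h2) ?_
  rw [chartOne_symm_coordOne, mul_one]

theorem contDiffAt_chartConj :
    ContDiffAt ℝ ∞ (chartConj E G) (coordOne E G, coordOne E G) := by
  rw [← contMDiffAt_iff_contDiffAt]
  have h1 : ContMDiffAt 𝓘(ℝ, E × E) 𝓘(ℝ, E) ∞
      (fun p : E × E => (chartOne E G).symm p.1) (coordOne E G, coordOne E G) :=
    ContMDiffAt.comp (x := (coordOne E G, coordOne E G)) (f := Prod.fst) (I' := 𝓘(ℝ, E))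
      contMDiffAt_chartOne_symm contDiffAt_fst.contMDiffAt
  have h2 : ContMDiffAt 𝓘(ℝ, E × E) 𝓘(ℝ, E) ∞
      (fun p : E × E => (chartOne E G).symm p.2) (coordOne E G, coordOne E G) :=
    ContMDiffAt.comp (x := (coordOne E G, coordOne E G)) (f := Prod.snd) (I' := 𝓘(ℝ, E))
      contMDiffAt_chartOne_symm contDiffAt_snd.contMDiffAt
  refine ContMDiffAt.comp_of_eq (I' := 𝓘(ℝ, E)) contMDiffAt_extChartAt
    ((h1.mul h2).mul h1.inv) ?_
  rw [chartOne_symm_coordOne, mul_one, mul_inv_cancel]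

theorem eventually_symm_mem_source : ∀ᶠ p in 𝓝 (coordOne E G, coordOne E G),
    (chartOne E G).symm p.1 * (chartOne E G).symm p.2 * ((chartOne E G).symm p.1)⁻¹ ∈
      (chartOne E G).source := by
  have := topologicalGroup_of_lieGroup 𝓘(ℝ, E) ∞ (G := G)
  have hs : ContinuousAt (chartOne E G).symm (coordOne E G) :=
    contMDiffAt_chartOne_symm.continuousAt
  have h1 : ContinuousAt (fun p : E × E => (chartOne E G).symm p.1)
      (coordOne E G, coordOne E G) := ContinuousAt.comp (f := Prod.fst) hs continuousAt_fst
  have h2 : ContinuousAt (fun p : E × E => (chartOne E G).symm p.2)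
      (coordOne E G, coordOne E G) := ContinuousAt.comp (f := Prod.snd) hs continuousAt_snd
  refine ((h1.mul h2).mul h1.inv).eventually_mem (s := (chartOne E G).source) ?_
  change _ ∈ 𝓝 ((chartOne E G).symm (coordOne E G) * (chartOne E G).symm (coordOne E G) *
    ((chartOne E G).symm (coordOne E G))⁻¹)
  rw [chartOne_symm_coordOne, mul_one, mul_inv_cancel]
  exact extChartAt_source_mem_nhds (I := 𝓘(ℝ, E)) (1 : G)

theorem chartMul_chartConj : ∀ᶠ p in 𝓝 (coordOne E G, coordOne E G),
    chartMul E G (chartConj E G p, p.1) = chartMul E G p := by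
  filter_upwards [eventually_symm_mem_source (E := E) (G := G)] with p hp
  simp only [chartMul, chartConj]
  rw [(chartOne E G).left_inv hp]
  simp

theorem Ad_eq_fderiv (g : G) (X : E) :
    (Ad (E := E) g X : E) =
      fderiv ℝ (fun y => chartOne E G (g * (chartOne E G).symm y * g⁻¹)) (coordOne E G) X := by
  have hf : MDifferentiableAt 𝓘(ℝ, E) 𝓘(ℝ, E) (fun x : G => g * x * g⁻¹) 1 :=
    (((contMDiff_mul_right (I := 𝓘(ℝ, E)) (n := ∞) (a := g⁻¹)).comp
      (contMDiff_mul_left (a := g))).contMDiffAt).mdifferentiableAt (by simp)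
  simp only [Ad, mfderiv, hf, writtenInExtChartAt, ModelWithCorners.range_eq_univ, fderivWithin_univ]
  have h1 : g * 1 * g⁻¹ = 1 := by simp
  simp only [h1]
  rfl

theorem Ad_symm_eq_fderiv : ∀ᶠ x in 𝓝 (coordOne E G), ∀ Y : E,
    (Ad (E := E) ((chartOne E G).symm x) Y : E) =
      fderiv ℝ (chartConj E G) (x, coordOne E G) (0, Y) := by
  have htl : Tendsto (fun x : E => (x, coordOne E G)) (𝓝 (coordOne E G))
    (𝓝 (coordOne E G, coordOne E G)) := (Continuous.prodMk_left _).continuousAt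
  filter_upwards [htl.eventually ((contDiffAt_chartConj (E := E) (G := G)).of_le
    (m := 2) ENat.LEInfty.out |>.eventually (by simp))] with x hx Y
  rw [Ad_eq_fderiv]
  have := HasFDerivAt.comp (coordOne E G) (f := fun y : E => (x, y)) (hx.differentiableAt (by norm_num)).hasFDerivAt
    (hasFDerivAt_prodMk_right x (coordOne E G))
  have h2 := this.fderiv
  change fderiv ℝ (fun y => chartOne E G ((chartOne E G).symm x * (chartOne E G).symm y * _)) _ = _ at h2
  rw [h2]
  rfl

/-- An invariant field is the derivative of left translation at 1, which in the chart is the partial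
derivative of `chartMul` in its second slot. This makes the Lie bracket computable from `chartMul`.
-/
theorem mpullback_mulInvariantVectorField_eq (Y : E) : ∀ᶠ x in 𝓝 (coordOne E G),
    (mpullbackWithin 𝓘(ℝ, E) 𝓘(ℝ, E) (chartOne E G).symm
      (mulInvariantVectorField (I := 𝓘(ℝ, E)) (G := G) Y) (Set.range 𝓘(ℝ, E)) x : E) =
      fderiv ℝ (chartMul E G) (x, coordOne E G) (0, Y) := by
  have htl : Tendsto (fun x : E => (x, coordOne E G)) (𝓝 (coordOne E G))
    (𝓝 (coordOne E G, coordOne E G)) := (Continuous.prodMk_left _).continuousAt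
  filter_upwards [eventually_mem_target,
    htl.eventually ((contDiffAt_chartMul (E := E) (G := G)).of_le
    (m := 2) ENat.LEInfty.out |>.eventually (by simp))] with x hxt hx
  have hinv := ContinuousLinearMap.inverse_eq
    (mfderivWithin_extChartAt_symm_comp_mfderiv_extChartAt (I := 𝓘(ℝ, E)) hxt)
    (mfderiv_extChartAt_comp_mfderivWithin_extChartAt_symm (I := 𝓘(ℝ, E)) hxt)
  have hsrc : (chartOne E G).symm x ∈ (chartAt E (1 : G)).source := by
    rw [← extChartAt_source (I := 𝓘(ℝ, E))]
    exact (chartOne E G).map_target hxt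
  have hL : MDifferentiableAt 𝓘(ℝ, E) 𝓘(ℝ, E) (fun y : G => (chartOne E G).symm x * y) 1 :=
    (contMDiff_mul_left (I := 𝓘(ℝ, E)) (n := ∞)).contMDiffAt.mdifferentiableAt (by simp)
  have hφ : MDifferentiableAt 𝓘(ℝ, E) 𝓘(ℝ, E) (chartOne E G) ((chartOne E G).symm x) :=
    mdifferentiableAt_extChartAt (I := 𝓘(ℝ, E)) hsrc
  have hcomp := mfderiv_comp_of_eq (g := chartOne E G) hφ hL (mul_one _)
  have hone := mfderiv_one_eq_fderiv (E := E) (MDifferentiableAt.comp_of_eq (1 : G) hφ hL (mul_one _))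
  have h2 := (HasFDerivAt.comp (coordOne E G) (f := fun y : E => (x, y))
    (hx.differentiableAt (by norm_num)).hasFDerivAt
    (hasFDerivAt_prodMk_right x (coordOne E G))).fderiv
  change fderiv ℝ (fun y => chartOne E G ((chartOne E G).symm x * (chartOne E G).symm y)) _ = _ at h2
  simp only [Function.comp_def] at hone
  rw [h2] at hone
  simp only [mpullbackWithin, mulInvariantVectorField]
  rw [hinv]
  -- The points x * 1 and x are equal only propositionally, so derivatives at them are compared by
  -- eliminating the equality.
  have hbase : ∀ g h : G, g = h → ∀ Z : E,
      (mfderiv 𝓘(ℝ, E) 𝓘(ℝ, E) (chartOne E G) g : E →L[ℝ] E) Z =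
        (mfderiv 𝓘(ℝ, E) 𝓘(ℝ, E) (chartOne E G) h : E →L[ℝ] E) Z := by
    rintro _ _ rfl _
    rfl
  exact (hbase _ _ (mul_one _).symm _).trans
    (congrArg (fun T : E →L[ℝ] E => T Y) (hcomp.symm.trans hone))

end ChartCalculus

end AdjointOrbit

namespace AdjointOrbit

open Filter Topology VectorField

section Velocity

variable {E : Type*} [NormedAddCommGroup E] [NormedSpace ℝ E]
  {G : Type*} [TopologicalSpace G] [ChartedSpace E G]

/-- The velocity of a curve in a manifold. -/
noncomputable def velocity (c : ℝ → G) (s : ℝ) : E :=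
  (mfderiv 𝓘(ℝ, ℝ) 𝓘(ℝ, E) c s : ℝ →L[ℝ] E) 1

theorem hasDerivAt_extChartAt_comp {c : ℝ → G} {s : ℝ} {p : G} (hp : c s = p)
    (hc : MDifferentiableAt 𝓘(ℝ, ℝ) 𝓘(ℝ, E) c s) :
    HasDerivAt (fun t => extChartAt 𝓘(ℝ, E) p (c t)) (velocity (E := E) c s) s := by
  subst hp
  have h0 : HasFDerivWithinAt (fun t => extChartAt 𝓘(ℝ, E) (c s) (c t))
    (mfderiv 𝓘(ℝ, ℝ) 𝓘(ℝ, E) c s : ℝ →L[ℝ] E) (Set.range 𝓘(ℝ, ℝ)) s := hc.hasMFDerivAt.2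
  exact HasFDerivAt.hasDerivAt (F := E) (h0.hasFDerivAt (by simp))

end Velocity

/-! ### The adjoint representation and its differential. -/

section AdjointAction

variable {E : Type*} [NormedAddCommGroup E] [NormedSpace ℝ E]
  {G : Type*} [TopologicalSpace G] [ChartedSpace E G] [Group G]

variable (E) in
/-- The adjoint action as a continuous linear map on the model space. -/
noncomputable def AdL (g : G) : E →L[ℝ] E :=
  mfderiv 𝓘(ℝ, E) 𝓘(ℝ, E) (fun x : G => g * x * g⁻¹) 1

theorem AdL_apply (g : G) (X : E) : AdL E g X = Ad (E := E) g X := rfl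

theorem AdL_one : AdL E (1 : G) = ContinuousLinearMap.id ℝ E := by
  have : (fun x : G => 1 * x * 1⁻¹) = id := by ext; simp
  rw [AdL, this]
  exact mfderiv_id

variable [LieGroup 𝓘(ℝ, E) ∞ G]

theorem mdifferentiableAt_conj (g x : G) :
    MDifferentiableAt 𝓘(ℝ, E) 𝓘(ℝ, E) (fun x : G => g * x * g⁻¹) x :=
  (((contMDiff_mul_right (I := 𝓘(ℝ, E)) (n := ∞) (a := g⁻¹)).comp
      (contMDiff_mul_left (a := g))).contMDiffAt).mdifferentiableAt (by simp)

theorem AdL_mul (g h : G) : AdL E (g * h) = (AdL E g).comp (AdL E h) := by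
  have hfun : (fun x : G => g * h * x * (g * h)⁻¹) =
      (fun x : G => g * x * g⁻¹) ∘ fun x : G => h * x * h⁻¹ := by
    ext; simp [mul_assoc]
  have hcomp := mfderiv_comp_of_eq (x := (1 : G)) (y := 1) (mdifferentiableAt_conj (E := E) g 1)
    (mdifferentiableAt_conj (E := E) h 1) (by simp)
  rw [← hfun] at hcomp
  have hbase : ∀ p q : G, p = q → ∀ Z : E,
      (mfderiv 𝓘(ℝ, E) 𝓘(ℝ, E) (fun x : G => g * x * g⁻¹) p : E →L[ℝ] E) Z =
        (mfderiv 𝓘(ℝ, E) 𝓘(ℝ, E) (fun x : G => g * x * g⁻¹) q : E →L[ℝ] E) Z := by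
    rintro _ _ rfl _
    rfl
  ext Z
  exact (congrArg (fun T : E →L[ℝ] E => T Z) hcomp).trans (hbase _ _ (by simp) _)

theorem AdL_inv_apply_apply (g : G) (X : E) : AdL E g⁻¹ (AdL E g X) = X := by
  rw [← ContinuousLinearMap.comp_apply, ← AdL_mul, inv_mul_cancel, AdL_one]
  rfl

theorem AdL_apply_inv_apply (g : G) (X : E) : AdL E g (AdL E g⁻¹ X) = X := by
  simpa using AdL_inv_apply_apply g⁻¹ X

variable (E G) in
/-- The adjoint action in the chart at the identity. -/
noncomputable def chartAd (x : E) : E →L[ℝ] E := AdL E ((chartOne E G).symm x)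

theorem chartAd_eventuallyEq : chartAd E G =ᶠ[𝓝 (coordOne E G)] fun x =>
    (fderiv ℝ (chartConj E G) (x, coordOne E G)).comp (ContinuousLinearMap.inr ℝ E E) := by
  filter_upwards [Ad_symm_eq_fderiv (E := E) (G := G)] with x hx
  ext Y
  exact hx Y

theorem contDiffAt_chartAd : ContDiffAt ℝ 1 (chartAd E G) (coordOne E G) := by
  refine ContDiffAt.congr_of_eventuallyEq ?_ chartAd_eventuallyEq
  have h1 : ContDiffAt ℝ 1 (fderiv ℝ (chartConj E G)) (coordOne E G, coordOne E G) :=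
    (contDiffAt_chartConj.of_le (n := ∞) (m := 2) ENat.LEInfty.out).fderiv_right (by norm_num)
  have h2 : ContDiffAt ℝ 1 (fun x : E => (x, coordOne E G)) (coordOne E G) :=
    contDiffAt_id.prodMk contDiffAt_const
  exact (ContDiffAt.comp (coordOne E G) (f := fun x : E => (x, coordOne E G)) h1 h2).clm_comp contDiffAt_const

variable (G) in
/-- The Lie bracket of the Lie algebra of `G`, as an operation on the model space. -/
noncomputable def bracketE (X Y : E) : E :=
  Bracket.bracket (L := GroupLieAlgebra 𝓘(ℝ, E) G) (M := GroupLieAlgebra 𝓘(ℝ, E) G) X Y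

theorem bracketE_eq (X Y : E) : bracketE G X Y =
      fderiv ℝ (fun x => fderiv ℝ (chartMul E G) (x, coordOne E G) (0, Y)) (coordOne E G) X -
        fderiv ℝ (fun x => fderiv ℝ (chartMul E G) (x, coordOne E G) (0, X)) (coordOne E G) Y := by
  have hX := mpullback_mulInvariantVectorField_eq (G := G) X
  have hY := mpullback_mulInvariantVectorField_eq (G := G) Y
  have hval : ∀ Z : E, fderiv ℝ (chartMul E G) (coordOne E G, coordOne E G) (0, Z) = Z := by
    intro Z
    have h1 := HasFDerivAt.comp (coordOne E G) (f := fun y : E => (coordOne E G, y))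
      ((contDiffAt_chartMul (E := E) (G := G)).differentiableAt (by simp)).hasFDerivAt
      (hasFDerivAt_prodMk_right (coordOne E G) (coordOne E G))
    have h2 : (chartMul E G ∘ fun y : E => (coordOne E G, y)) =ᶠ[𝓝 (coordOne E G)] id := by
      filter_upwards [eventually_mem_target (E := E) (G := G)] with y hy
      simp only [Function.comp_apply, chartMul, chartOne_symm_coordOne, one_mul]
      exact (chartOne E G).right_inv hy
    have := congrArg (fun T => T Z) (h1.unique ((hasFDerivAt_id _).congr_of_eventuallyEq h2))
    simpa using this
  refine (GroupLieAlgebra.bracket_def (I := 𝓘(ℝ, E)) (G := G) X Y).trans ?_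
  rw [mlieBracket, mlieBracketWithin_apply, mfderiv_extChartAt_self]
  erw [ContinuousLinearMap.inverse_id]
  simp only [Set.preimage_univ, Set.univ_inter, ModelWithCorners.range_eq_univ]
  rw [ModelWithCorners.range_eq_univ] at hX hY
  have h := Filter.EventuallyEq.lieBracket_vectorField_eq (𝕜 := ℝ) hX hY
  refine (congrFun (lieBracketWithin_univ (𝕜 := ℝ) (E := E)) _).trans (h.trans ?_)
  simp only [lieBracket, hval]

/-- The differential of Ad is ad: `fderiv_conjugation_eq` applied to the group law in the chart,
with `bracketE_eq` on the other side. -/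
theorem fderiv_chartAd (X Y : E) :
    fderiv ℝ (chartAd E G) (coordOne E G) X Y = bracketE G X Y := by
  rw [bracketE_eq, ← fderiv_conjugation_eq (c := chartConj E G)
    (contDiffAt_chartMul.of_le ENat.LEInfty.out) (contDiffAt_chartConj.of_le ENat.LEInfty.out)
    ?_ ?_ ?_ chartMul_chartConj]
  · have h := contDiffAt_chartAd (E := E) (G := G) |>.differentiableAt (by simp)
    have h2 := (h.hasFDerivAt.clm_apply (hasFDerivAt_const Y _)).congr_of_eventuallyEq
      (f₁ := fun x => fderiv ℝ (chartConj E G) (x, coordOne E G) (0, Y)) (by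
        filter_upwards [chartAd_eventuallyEq (E := E) (G := G)] with x hx
        rw [hx]
        rfl)
    rw [h2.fderiv]
    simp
  · filter_upwards [eventually_mem_target (E := E) (G := G)] with y hy
    simp only [chartMul, chartOne_symm_coordOne, mul_one]
    exact (chartOne E G).right_inv hy
  · refine Eventually.of_forall fun x => ?_
    simp only [chartConj, chartOne_symm_coordOne, mul_one, mul_inv_cancel]
  · filter_upwards [eventually_mem_target (E := E) (G := G)] with y hy
    simp only [chartConj, chartOne_symm_coordOne, one_mul, inv_one, mul_one]
    exact (chartOne E G).right_inv hy

/-- The chart gives continuity at 1 only; multiplicativity of Ad carries it to every point. -/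
theorem continuous_AdL : Continuous (AdL E : G → E →L[ℝ] E) := by
  have := topologicalGroup_of_lieGroup 𝓘(ℝ, E) ∞ (G := G)
  have h1 : ContinuousAt (AdL E : G → E →L[ℝ] E) 1 := by
    have h2 : ContinuousAt (fun g : G => chartAd E G (chartOne E G g)) 1 :=
      ContinuousAt.comp (f := chartOne E G)
        (contDiffAt_chartAd (E := E) (G := G)).continuousAt (continuousAt_extChartAt (1 : G))
    refine h2.congr ?_
    filter_upwards [extChartAt_source_mem_nhds (I := 𝓘(ℝ, E)) (1 : G)] with g hg
    exact congrArg (AdL E) ((chartOne E G).left_inv hg)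
  rw [continuous_iff_continuousAt]
  intro g
  have h3 : (AdL E : G → E →L[ℝ] E) = fun x => (AdL E g).comp (AdL E (g⁻¹ * x)) := by
    ext1 x
    rw [← AdL_mul, mul_inv_cancel_left]
  rw [h3]
  refine ContinuousAt.clm_comp continuousAt_const ?_
  refine ContinuousAt.comp_of_eq h1 (continuous_const_mul g⁻¹).continuousAt (by simp)

/-- The derivative of the adjoint action along a curve through the identity. -/
theorem hasDerivAt_AdL {c : ℝ → G} {s : ℝ} (hc1 : c s = 1)
    (hc : MDifferentiableAt 𝓘(ℝ, ℝ) 𝓘(ℝ, E) c s) (Y : E) :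
    HasDerivAt (fun t => AdL E (c t) Y) (bracketE G (velocity c s) Y) s := by
  have hA := (contDiffAt_chartAd (E := E) (G := G)).differentiableAt (by simp) |>.hasFDerivAt
  have h1 : HasDerivAt (fun t => chartAd E G (chartOne E G (c t)))
      (fderiv ℝ (chartAd E G) (coordOne E G) (velocity c s)) s :=
    hA.comp_hasDerivAt_of_eq s (hasDerivAt_extChartAt_comp hc1 hc) (by rw [hc1])
  have h2 : (fun t => AdL E (c t)) =ᶠ[𝓝 s] fun t => chartAd E G (chartOne E G (c t)) := by
    have hev : ∀ᶠ t in 𝓝 s, c t ∈ (chartOne E G).source :=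
      hc.continuousAt.eventually_mem
        (by rw [hc1]; exact extChartAt_source_mem_nhds (I := 𝓘(ℝ, E)) (1 : G))
    filter_upwards [hev] with t ht
    exact congrArg (AdL E) ((chartOne E G).left_inv ht).symm
  have h3 := (h1.congr_of_eventuallyEq h2).clm_apply (hasDerivAt_const s Y)
  rw [map_zero, add_zero, fderiv_chartAd] at h3
  exact h3

/-- Every vector in the Lie algebra is the velocity of a curve. -/
theorem exists_curve (X : E) : ∃ c : ℝ → G, c 0 = 1 ∧ MDifferentiableAt 𝓘(ℝ, ℝ) 𝓘(ℝ, E) c 0 ∧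
    velocity c 0 = X := by
  have hl : HasMFDerivAt 𝓘(ℝ, ℝ) 𝓘(ℝ, E) (fun t : ℝ => coordOne E G + t • X) 0
      ((1 : ℝ →L[ℝ] ℝ).smulRight X) := by
    have : HasFDerivAt (fun t : ℝ => coordOne E G + t • X) ((1 : ℝ →L[ℝ] ℝ).smulRight X) 0 := by
      have h := ((hasDerivAt_id (0 : ℝ)).smul_const X).const_add (coordOne E G)
      rw [one_smul] at h
      exact h.hasFDerivAt
    exact this.hasMFDerivAt
  have hs : HasMFDerivAt 𝓘(ℝ, E) 𝓘(ℝ, E) (chartOne E G).symm (coordOne E G)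
      (ContinuousLinearMap.id ℝ E) := by
    have h1 := (contMDiffAt_chartOne_symm (E := E) (G := G)).mdifferentiableAt (by simp)
    have h2 := mfderivWithin_range_extChartAt_symm (I := 𝓘(ℝ, E)) (x := (1 : G))
    rw [ModelWithCorners.range_eq_univ, mfderivWithin_univ] at h2
    have h3 := h1.hasMFDerivAt
    rw [h2] at h3
    exact h3
  have h0 : coordOne E G + (0 : ℝ) • X = coordOne E G := by simp
  have hcomp := HasMFDerivAt.comp (0 : ℝ) (f := fun t : ℝ => coordOne E G + t • X)
    (g := (chartOne E G).symm) (by rw [h0]; exact hs) hl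
  refine ⟨(chartOne E G).symm ∘ fun t : ℝ => coordOne E G + t • X, ?_, hcomp.mdifferentiableAt, ?_⟩
  · simp only [Function.comp_apply, h0, chartOne_symm_coordOne]
  · rw [velocity, hcomp.mfderiv]
    exact one_smul ℝ X

end AdjointAction

end AdjointOrbit

namespace AdjointOrbit

open Filter Topology Polynomial

/-! ### Differentiating f(A) for noncommuting A, with f separable. -/

section PolynomialCalculus

variable {R : Type*} [NormedRing R] [NormedAlgebra ℝ R]

/-- The derivative of a polynomial map on a noncommutative algebra, in directions that commute with
the base point and up to commutators. -/
theorem exists_hasFDerivAt_aeval (A : R) (f : ℝ[X]) :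
    ∃ D : R →L[ℝ] R, HasFDerivAt (fun B : R => aeval B f) D A ∧
      (∀ N, Commute N A → D N = aeval A (derivative f) * N) ∧
      ∀ τ : R →ₗ[ℝ] ℝ, (∀ x y, τ (x * y) = τ (y * x)) → ∀ N Z, Commute Z A →
        τ (D N * Z) = τ (N * aeval A (derivative f) * Z) := by
  induction f using Polynomial.induction_on with
  | C a =>
    refine ⟨0, ?_, by simp, by simp⟩
    simpa using hasFDerivAt_const (algebraMap ℝ R a) A
  | add p q hp hq =>
    obtain ⟨D, hD, hD1, hD2⟩ := hp
    obtain ⟨D', hD', hD1', hD2'⟩ := hq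
    refine ⟨D + D', ?_, fun N hN => ?_, fun τ hτ N Z hZ => ?_⟩
    · exact (hD.add hD').congr_of_eventuallyEq (Eventually.of_forall fun B => by simp)
    · simp [hD1 N hN, hD1' N hN, add_mul]
    · simp [add_mul, mul_add, hD2 τ hτ N Z hZ, hD2' τ hτ N Z hZ]
  | monomial n a hp =>
    obtain ⟨D, hD, hD1, hD2⟩ := hp
    set p : ℝ[X] := C a * X ^ n with hpdef
    have hpX : C a * X ^ (n + 1) = p * X := by rw [hpdef, pow_succ, mul_assoc]
    have hcomm : ∀ q : ℝ[X], ∀ N, Commute N A → Commute N (aeval A q) := by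
      intro q N hN
      induction q using Polynomial.induction_on' with
      | add q r hq hr => rw [map_add]; exact hq.add_right hr
      | monomial k b =>
        rw [aeval_monomial]
        exact (Algebra.commute_algebraMap_right b N).mul_right (hN.pow_right k)
    have hD' : ∀ N, ((((ContinuousLinearMap.mul ℝ R).flip A).comp D +
        ContinuousLinearMap.mul ℝ R (aeval A p)) N : R) = D N * A + aeval A p * N := fun N => rfl
    refine ⟨((ContinuousLinearMap.mul ℝ R).flip A).comp D +
      ContinuousLinearMap.mul ℝ R (aeval A p), ?_, fun N hN => ?_, fun τ hτ N Z hZ => ?_⟩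
    · have h := (hD.mul' (hasFDerivAt_id A)).congr_of_eventuallyEq
        (f₁ := fun B => aeval B (C a * X ^ (n + 1)))
        (Eventually.of_forall fun B => by simp [hpX])
      refine h.congr_fderiv ?_
      ext N
      rw [hD', add_comm]
      simp
    · rw [hD', hD1 N hN, hpX]
      simp only [derivative_mul, derivative_X, mul_one, map_add, map_mul, aeval_X, add_mul,
        mul_assoc, hN.eq]
    -- The induction hypothesis is needed at `A * Z`, which still commutes with A; hence the
    -- arbitrary Z in the statement.
    · have h1 := hD2 τ hτ N (A * Z) ((Commute.refl A).mul_left hZ)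
      have h2 := hτ (aeval A p) (N * Z)
      rw [hD', hpX]
      simp only [derivative_mul, derivative_X, mul_one, map_add, map_mul, aeval_X, add_mul,
        mul_add, mul_assoc] at h1 h2 ⊢
      rw [h1, h2, (hcomm p Z hZ).eq]

/-- The velocity of a curve of roots of a separable polynomial is orthogonal for the trace form to
everything that commutes with the base point. -/
theorem trace_mul_eq_zero_of_aeval_eq_zero {f : ℝ[X]} (hf : f.Separable) {A : ℝ → R} {A' : R}
    {s : ℝ} (hA : HasDerivAt A A' s) (hfA : ∀ t, aeval (A t) f = 0) (τ : R →ₗ[ℝ] ℝ)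
    (hτ : ∀ x y, τ (x * y) = τ (y * x)) {Z : R} (hZ : Commute Z (A s)) : τ (A' * Z) = 0 := by
  obtain ⟨D, hD, -, hD2⟩ := exists_hasFDerivAt_aeval (A s) f
  have h1 : HasDerivAt (fun t => aeval (A t) f) (D A') s := hD.comp_hasDerivAt s hA
  simp only [hfA] at h1
  have h0 : D A' = 0 := h1.unique (hasDerivAt_const s 0)
  -- Evaluating a f + b f' = 1 at the root makes b(A) an inverse of f'(A); testing against b(A) Z
  -- below then cancels f'(A).
  obtain ⟨a, b, hab⟩ := hf
  have hb : aeval (A s) (derivative f) * aeval (A s) b = 1 := by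
    have := congrArg (aeval (A s)) hab
    rw [map_add, map_mul, map_mul, hfA, mul_zero, zero_add, map_one] at this
    rw [← map_mul, mul_comm, map_mul, this]
  have hbA : Commute (aeval (A s) b) (A s) := by
    have := Commute.map (mul_comm b X : Commute b X) (aeval (A s))
    rwa [aeval_X] at this
  have h2 := hD2 τ hτ A' (aeval (A s) b * Z) (hbA.mul_left hZ)
  rw [h0, zero_mul, map_zero] at h2
  rw [h2, mul_assoc, ← mul_assoc (aeval (A s) (derivative f)), hb, one_mul]

/-- A root of a separable polynomial is isolated among the roots that commute with it. -/
theorem eventually_eq_zero_of_commute {f : ℝ[X]} (hf : f.Separable) {A : R}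
    (hfA : aeval A f = 0) :
    ∀ᶠ N in 𝓝 (0 : R), Commute N A → aeval (A + N) f = 0 → N = 0 := by
  obtain ⟨D, hD, hD1, -⟩ := exists_hasFDerivAt_aeval A f
  obtain ⟨a, b, hab⟩ := hf
  have hb : aeval A b * aeval A (derivative f) = 1 := by
    have := congrArg (aeval A) hab
    rwa [map_add, map_mul, map_mul, hfA, mul_zero, zero_add, map_one] at this
  rw [hasFDerivAt_iff_isLittleO_nhds_zero] at hD
  have hpos : (0 : ℝ) < ‖aeval A b‖ + 1 := by positivity
  -- With this constant, inverting f'(A) turns the remainder estimate into ‖N‖ ≤ ‖N‖ / 2; the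
  -- summand 1 keeps the denominator positive.
  have h2 := hD.def (c := (2 * (‖aeval A b‖ + 1))⁻¹) (by positivity)
  filter_upwards [h2] with N hN hc hz
  rw [hz, hfA, sub_zero, zero_sub, norm_neg, hD1 N hc] at hN
  have h3 : N = aeval A b * (aeval A (derivative f) * N) := by rw [← mul_assoc, hb, one_mul]
  have h4 : ‖N‖ ≤ ‖aeval A b‖ * ‖aeval A (derivative f) * N‖ := by
    conv_lhs => rw [h3]
    exact norm_mul_le _ _
  have h5 : ‖N‖ ≤ (‖aeval A b‖ + 1) * ((2 * (‖aeval A b‖ + 1))⁻¹ * ‖N‖) :=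
    h4.trans (mul_le_mul (by linarith) hN (norm_nonneg _) hpos.le)
  have h6 : (‖aeval A b‖ + 1) * ((2 * (‖aeval A b‖ + 1))⁻¹ * ‖N‖) = ‖N‖ / 2 := by
    field_simp
  rw [h6] at h5
  exact norm_le_zero_iff.1 (by linarith)

end PolynomialCalculus

/-! ### Semisimple endomorphisms. -/

section Semisimple

/-- Zero is at most a simple root of f. If f = X g, Bézout for f and f' becomes a relation between X
and g, splitting v into a range part and a kernel part; if f(0) ≠ 0, T is onto. -/
theorem exists_range_add_ker {V : Type*} [AddCommGroup V] [Module ℝ V] {T : Module.End ℝ V}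
    {f : ℝ[X]} (hf : f.Separable) (hfT : aeval T f = 0) (v : V) : ∃ u w, T w = 0 ∧ T u + w = v := by
  by_cases h0 : f.coeff 0 = 0
  · obtain ⟨g, rfl⟩ := X_dvd_iff.2 h0
    obtain ⟨a, b, hab⟩ := hf
    refine ⟨aeval T (a * g + b * derivative g) v, aeval T (b * g) v, ?_, ?_⟩
    · have h1 : aeval T (X * (b * g)) v = 0 := by
        rw [show X * (b * g) = b * (X * g) by ring, map_mul, hfT]
        simp
      simpa using h1
    · have h1 := congrArg (fun q => aeval T q v) hab
      rw [show a * (X * g) + b * derivative (X * g) =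
        X * (a * g + b * derivative g) + b * g by simp; ring] at h1
      simpa using h1
  · refine ⟨-(f.coeff 0)⁻¹ • aeval T f.divX v, 0, by simp, ?_⟩
    have h1 := congrArg (fun q => aeval T q v) (X_mul_divX_add f)
    simp only [map_add, map_mul, aeval_X, aeval_C, hfT, Module.End.mul_apply, LinearMap.add_apply,
      Module.algebraMap_end_apply, LinearMap.zero_apply] at h1
    rw [map_smul, eq_neg_of_add_eq_zero_left h1]
    simp [smul_smul, h0]

/-- The orthogonal complement of an invariant subspace is invariant, so T is semisimple and its
minimal polynomial is squarefree, hence separable over ℝ. -/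
theorem exists_separable_of_skew {V : Type*} [AddCommGroup V] [Module ℝ V] [FiniteDimensional ℝ V]
    {T : Module.End ℝ V} (b : LinearMap.BilinForm ℝ V) (hb : b.IsSymm)
    (hpos : ∀ x, x ≠ 0 → 0 < b x x) (hT : ∀ x y, b (T x) y = -b x (T y)) :
    ∃ f : ℝ[X], f.Separable ∧ aeval T f = 0 := by
  have hss : T.IsSemisimple := by
    rw [Module.End.isSemisimple_iff]
    intro p hp
    refine ⟨b.orthogonal p, ?_, ?_⟩
    · intro x hx
      rw [Submodule.mem_comap, LinearMap.BilinForm.mem_orthogonal_iff]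
      intro y hy
      rw [LinearMap.BilinForm.mem_orthogonal_iff] at hx
      have := hx (T y) (hp hy)
      rw [hT] at this
      exact neg_eq_zero.1 this
    · refine LinearMap.BilinForm.isCompl_orthogonal_of_restrict_nondegenerate hb.isRefl ?_
      have hsep : ∀ x : p, b x x = 0 → x = 0 := fun x hx => by
        by_contra hne
        exact (hpos x (by simpa using hne)).ne' hx
      exact ⟨fun x hx => hsep x (hx x), fun x hx => hsep x (hx x)⟩
  exact ⟨minpoly ℝ T, PerfectField.separable_iff_squarefree.2 hss.minpoly_squarefree,
    minpoly.aeval ℝ T⟩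

end Semisimple

end AdjointOrbit

namespace AdjointOrbit

open Filter Topology Polynomial

/-! ### Equivariance of the bracket, and centralizers as Lie algebras of stabilizers. -/

section LieGroup

variable {E : Type*} [NormedAddCommGroup E] [NormedSpace ℝ E]
  {G : Type*} [TopologicalSpace G] [ChartedSpace E G] [Group G] [LieGroup 𝓘(ℝ, E) ∞ G]

variable (E G) in
/-- The adjoint representation of the Lie algebra, on the model space. -/
noncomputable def adL : E →L[ℝ] E →L[ℝ] E := fderiv ℝ (chartAd E G) (coordOne E G)

theorem adL_apply (X Y : E) : adL E G X Y = bracketE G X Y := fderiv_chartAd X Y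

/-- Conjugating a curve through the identity applies the adjoint action to its velocity. -/
theorem velocity_conj {c : ℝ → G} (hc0 : c 0 = 1) (hc : MDifferentiableAt 𝓘(ℝ, ℝ) 𝓘(ℝ, E) c 0)
    (g : G) : MDifferentiableAt 𝓘(ℝ, ℝ) 𝓘(ℝ, E) (fun t => g * c t * g⁻¹) 0 ∧
      velocity (fun t => g * c t * g⁻¹) 0 = AdL E g (velocity c 0) := by
  have hconj : HasMFDerivAt 𝓘(ℝ, E) 𝓘(ℝ, E) (fun x : G => g * x * g⁻¹) (c 0)
      (mfderiv 𝓘(ℝ, E) 𝓘(ℝ, E) (fun x : G => g * x * g⁻¹) (c 0)) :=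
    (mdifferentiableAt_conj (E := E) g (c 0)).hasMFDerivAt
  have hcomp : HasMFDerivAt 𝓘(ℝ, ℝ) 𝓘(ℝ, E) (fun t => g * c t * g⁻¹) 0 _ :=
    HasMFDerivAt.comp (0 : ℝ) hconj hc.hasMFDerivAt
  refine ⟨hcomp.mdifferentiableAt, ?_⟩
  rw [velocity, hcomp.mfderiv]
  have hbase : ∀ p : G, p = 1 → ∀ Z : E,
      (mfderiv 𝓘(ℝ, E) 𝓘(ℝ, E) (fun x : G => g * x * g⁻¹) p : E →L[ℝ] E) Z = AdL E g Z := by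
    rintro _ rfl _
    rfl
  exact hbase (c 0) hc0 (velocity c 0)

/-- Both sides are the derivative at 0 of Ad(g c(t)) Y for a curve c through 1 with velocity X. -/
theorem bracketE_AdL (g : G) (X Y : E) :
    bracketE G (AdL E g X) (AdL E g Y) = AdL E g (bracketE G X Y) := by
  obtain ⟨c, hc0, hc, hcX⟩ := exists_curve (G := G) X
  obtain ⟨hmd, hvel⟩ := velocity_conj hc0 hc g
  have h1 := hasDerivAt_AdL (by simp [hc0]) hmd (AdL E g Y)
  rw [hvel, hcX] at h1
  have h2 := (AdL E g).hasFDerivAt.comp_hasDerivAt (0 : ℝ) (hasDerivAt_AdL hc0 hc Y)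
  rw [hcX] at h2
  refine h1.unique (h2.congr_of_eventuallyEq (Eventually.of_forall fun t => ?_))
  simp only [Function.comp_apply]
  rw [AdL_mul, AdL_mul]
  simp only [ContinuousLinearMap.comp_apply, AdL_inv_apply_apply]

theorem adL_AdL (g : G) (X : E) :
    adL E G (AdL E g X) * AdL E g = AdL E g * adL E G X := by
  ext Y
  simp [adL_apply, bracketE_AdL]

theorem AdL_mul_AdL_inv (g : G) : AdL E g * AdL E g⁻¹ = 1 := by
  ext Y
  simp [AdL_apply_inv_apply]

theorem AdL_inv_mul_AdL (g : G) : AdL E g⁻¹ * AdL E g = 1 := by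
  ext Y
  simp [AdL_inv_apply_apply]

/-- By `adL_AdL`, ad (Ad g X) is conjugate to ad X, so the same polynomials annihilate it: f(ad ·) =
0 holds on whole orbits. -/
theorem aeval_adL_AdL (g : G) (X : E) (f : ℝ[X]) (h : aeval (adL E G X) f = 0) :
    aeval (adL E G (AdL E g X)) f = 0 := by
  have key : ∀ q : ℝ[X], aeval (adL E G (AdL E g X)) q * AdL E g =
      AdL E g * aeval (adL E G X) q := by
    intro q
    induction q using Polynomial.induction_on with
    | C a =>
      simp only [aeval_C]
      exact Algebra.commutes a _
    | add p q hp hq => simp only [map_add, add_mul, mul_add, hp, hq]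
    | monomial n a hp =>
      have h2 : ∀ A : E →L[ℝ] E,
          aeval A (C a * Polynomial.X ^ (n + 1)) = aeval A (C a * Polynomial.X ^ n) * A := by
        intro A
        rw [pow_succ, ← mul_assoc, map_mul _ _ Polynomial.X, aeval_X]
      rw [h2, h2, mul_assoc, adL_AdL, ← mul_assoc, hp, mul_assoc]
  have h1 := key f
  rw [h, mul_zero] at h1
  calc aeval (adL E G (AdL E g X)) f
      = aeval (adL E G (AdL E g X)) f * AdL E g * AdL E g⁻¹ := by
        rw [mul_assoc, AdL_mul_AdL_inv, mul_one]
    _ = 0 := by rw [h1, zero_mul]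

theorem adL_bracketE [CompleteSpace E] (X Y : E) :
    adL E G (bracketE G X Y) = adL E G X * adL E G Y - adL E G Y * adL E G X := by
  ext Z
  simp only [adL_apply, mul_apply_eq_comp, sub_apply]
  exact lie_lie (L := GroupLieAlgebra 𝓘(ℝ, E) G) (M := GroupLieAlgebra 𝓘(ℝ, E) G) X Y Z

theorem bracketE_swap [CompleteSpace E] (X Y : E) : bracketE G Y X = -bracketE G X Y :=
  (lie_skew (L := GroupLieAlgebra 𝓘(ℝ, E) G) Y X).symm

theorem commute_adL [CompleteSpace E] {X Y : E} (h : bracketE G X Y = 0) : Commute (adL E G X) (adL E G Y) := by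
  have h1 := adL_bracketE (G := G) X Y
  rw [h, map_zero] at h1
  exact (sub_eq_zero.1 h1.symm)

/-- The derivative of left translation. -/
noncomputable def leftDeriv (g h : G) : E →L[ℝ] E :=
  mfderiv 𝓘(ℝ, E) 𝓘(ℝ, E) (fun x : G => g * x) h

theorem leftDeriv_inv_leftDeriv (g : G) (X : E) :
    leftDeriv g⁻¹ g (leftDeriv g (1 : G) X) = X := by
  have hd : ∀ a b : G, MDifferentiableAt 𝓘(ℝ, E) 𝓘(ℝ, E) (fun x : G => a * x) b := fun a b =>
    (contMDiff_mul_left (I := 𝓘(ℝ, E)) (n := ∞)).contMDiffAt.mdifferentiableAt (by simp)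
  have hcomp := mfderiv_comp_of_eq (x := (1 : G)) (y := g) (hd g⁻¹ g) (hd g 1) (mul_one g)
  have hid : (fun x : G => g⁻¹ * x) ∘ (fun x : G => g * x) = id := by ext; simp
  rw [hid, mfderiv_id] at hcomp
  have hbase : ∀ p : G, p = g → ∀ Z : E,
      (mfderiv 𝓘(ℝ, E) 𝓘(ℝ, E) (fun x : G => g⁻¹ * x) p : E →L[ℝ] E) Z = leftDeriv g⁻¹ g Z := by
    rintro _ rfl _
    rfl
  exact (hbase (g * 1) (mul_one g) _).symm.trans
    (congrArg (fun T : E →L[ℝ] E => T X) hcomp).symm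

/-- A vector in the centralizer of `Y` is the velocity of a curve in the stabilizer of `Y`. -/
theorem exists_curve_of_bracketE_eq_zero [CompleteSpace E] [T2Space G] {X Y : E}
    (h : bracketE G X Y = 0) :
    ∃ c : ℝ → G, (∀ t, AdL E (c t) Y = Y) ∧ c 0 = 1 ∧
      MDifferentiableAt 𝓘(ℝ, ℝ) 𝓘(ℝ, E) c 0 ∧ velocity c 0 = X := by
  have hsm : ContMDiffAt 𝓘(ℝ, E) 𝓘(ℝ, E).tangent 1
      (fun g : G => (⟨g, mulInvariantVectorField (I := 𝓘(ℝ, E)) (G := G) X g⟩ :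
        TangentBundle 𝓘(ℝ, E) G)) 1 :=
    (contMDiffAt_mulInvariantVectorField (I := 𝓘(ℝ, E)) (G := G) X).of_le
      (le_trans (by norm_num) (le_minSmoothness (𝕜 := ℝ) (n := 2)))
  -- A local integral curve of the left invariant field replaces the one-parameter subgroup of X.
  obtain ⟨γ, hγ0, hγ⟩ := exists_isMIntegralCurveAt_of_contMDiffAt_boundaryless (t₀ := 0) hsm
  obtain ⟨ε, hε, hball⟩ := Metric.eventually_nhds_iff_ball.1 hγ
  -- Ad(γ(s)) Y = Ad(γ(t)) Ad(γ(t)⁻¹ γ(s)) Y, and γ(t)⁻¹ γ passes through 1 at time t with velocity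
  -- X, so the derivative is Ad(γ(t)) [X, Y] = 0.
  have hderiv : ∀ t ∈ Metric.ball (0 : ℝ) ε, HasDerivAt (fun s => AdL E (γ s) Y) 0 t := by
    intro t ht
    have hmf := hball t ht
    have hl : HasMFDerivAt 𝓘(ℝ, E) 𝓘(ℝ, E) (fun x : G => (γ t)⁻¹ * x) (γ t)
        (mfderiv 𝓘(ℝ, E) 𝓘(ℝ, E) (fun x : G => (γ t)⁻¹ * x) (γ t)) :=
      ((contMDiff_mul_left (I := 𝓘(ℝ, E)) (n := ∞)).contMDiffAt.mdifferentiableAt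
        (by simp)).hasMFDerivAt
    have hcomp := HasMFDerivAt.comp t hl hmf
    have hvel : velocity ((fun x : G => (γ t)⁻¹ * x) ∘ γ) t = X := by
      rw [velocity, hcomp.mfderiv]
      have : leftDeriv (γ t)⁻¹ (γ t) ((1 : ℝ) • leftDeriv (γ t) (1 : G) X) = X := by
        rw [one_smul, leftDeriv_inv_leftDeriv]
      exact this
    have h1 := hasDerivAt_AdL (c := (fun x : G => (γ t)⁻¹ * x) ∘ γ) (s := t) (by simp)
      hcomp.mdifferentiableAt Y
    rw [hvel, h] at h1
    have h2 := (AdL E (γ t)).hasFDerivAt.comp_hasDerivAt t h1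
    rw [map_zero] at h2
    refine h2.congr_of_eventuallyEq (Eventually.of_forall fun s => ?_)
    simp only [Function.comp_apply]
    rw [AdL_mul, ContinuousLinearMap.comp_apply, AdL_apply_inv_apply]
  have hconst : ∀ t ∈ Metric.ball (0 : ℝ) ε, AdL E (γ t) Y = Y := by
    intro t ht
    have h1 := (convex_ball (0 : ℝ) ε).is_const_of_fderivWithin_eq_zero (𝕜 := ℝ)
      (f := fun s => AdL E (γ s) Y)
      (fun s hs => (hderiv s hs).differentiableAt.differentiableWithinAt)
      (fun s hs => by
        rw [fderivWithin_of_isOpen Metric.isOpen_ball hs, (hderiv s hs).hasFDerivAt.fderiv]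
        simp) ht (Metric.mem_ball_self hε)
    simpa [hγ0, AdL_one] using h1
  classical
  -- Outside the ball the curve is set to 1, so that it stays in the stabilizer for all times.
  have hcγ : (fun t => if t ∈ Metric.ball (0 : ℝ) ε then γ t else 1) =ᶠ[𝓝 0] γ := by
    filter_upwards [Metric.ball_mem_nhds (0 : ℝ) hε] with t ht
    exact if_pos ht
  have hmf0 := (hball 0 (Metric.mem_ball_self hε)).congr_of_eventuallyEq hcγ
  refine ⟨fun t => if t ∈ Metric.ball (0 : ℝ) ε then γ t else 1, fun t => ?_, ?_,
    hmf0.mdifferentiableAt, ?_⟩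
  · by_cases ht : t ∈ Metric.ball (0 : ℝ) ε
    · simp only [if_pos ht]
      exact hconst t ht
    · simp only [if_neg ht, AdL_one]
      rfl
  · simp only [if_pos (Metric.mem_ball_self hε), hγ0]
  · rw [velocity, hmf0.mfderiv]
    have hbase : ∀ p : G, p = 1 → (1 : ℝ) • leftDeriv p (1 : G) X = X := by
      rintro _ rfl
      have : (fun x : G => 1 * x) = id := by ext; simp
      rw [leftDeriv, this, mfderiv_id, one_smul]
      rfl
    exact hbase (γ 0) hγ0

end LieGroup

end AdjointOrbit

namespace AdjointOrbit

open Filter Topology Polynomial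

/-! ### The trace and the Killing form on the model space. -/

section Trace

variable {E : Type*} [NormedAddCommGroup E] [NormedSpace ℝ E]

variable (E) in
/-- The trace of a continuous endomorphism. -/
noncomputable def traceL : (E →L[ℝ] E) →ₗ[ℝ] ℝ :=
  LinearMap.trace ℝ E ∘ₗ ContinuousLinearMap.coeLM ℝ

theorem traceL_mul_comm (S T : E →L[ℝ] E) : traceL E (S * T) = traceL E (T * S) :=
  LinearMap.trace_mul_comm ℝ (S : E →ₗ[ℝ] E) T

theorem aeval_toLinearMap (T : E →L[ℝ] E) (f : ℝ[X]) :
    aeval (T : E →ₗ[ℝ] E) f = ((aeval T f : E →L[ℝ] E) : E →ₗ[ℝ] E) := by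
  induction f using Polynomial.induction_on with
  | C a => ext; simp
  | add p q hp hq => rw [map_add, map_add, hp, hq]; rfl
  | monomial n a hp =>
    rw [pow_succ, ← mul_assoc, map_mul, map_mul _ (C a * Polynomial.X ^ n), hp, aeval_X, aeval_X]
    rfl

end Trace

section KillingForm

variable {E : Type*} [NormedAddCommGroup E] [NormedSpace ℝ E]
  {G : Type*} [TopologicalSpace G] [ChartedSpace E G] [Group G]

variable (G) in
/-- The Killing form of the Lie algebra of `G`, on the model space. -/
noncomputable def killE (X Y : E) : ℝ := traceL E (adL E G X * adL E G Y)

theorem killE_comm (X Y : E) : killE G X Y = killE G Y X := traceL_mul_comm _ _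

variable [LieGroup 𝓘(ℝ, E) ∞ G]

theorem killE_AdL (g : G) (X Y : E) : killE G (AdL E g X) (AdL E g Y) = killE G X Y := by
  have h : ∀ Z : E, adL E G (AdL E g Z) = AdL E g * adL E G Z * AdL E g⁻¹ := by
    intro Z
    rw [← adL_AdL, mul_assoc, AdL_mul_AdL_inv, mul_one]
  rw [killE, h, h, killE, traceL_mul_comm]
  have h2 : AdL E g * adL E G Y * AdL E g⁻¹ * (AdL E g * adL E G X * AdL E g⁻¹) =
      AdL E g * (adL E G Y * adL E G X * AdL E g⁻¹) := by
    simp only [mul_assoc]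
    rw [← mul_assoc (AdL E g⁻¹) (AdL E g), AdL_inv_mul_AdL, one_mul]
  rw [h2, traceL_mul_comm, mul_assoc, AdL_inv_mul_AdL, mul_one, traceL_mul_comm]

theorem killingForm_eq_killE [CompleteSpace E] (X Y : E) :
    killingForm ℝ (GroupLieAlgebra 𝓘(ℝ, E) G) X Y = killE G X Y := by
  have h : ∀ Z : E, (LieAlgebra.ad ℝ (GroupLieAlgebra 𝓘(ℝ, E) G) Z : E →ₗ[ℝ] E) =
      (adL E G Z : E →ₗ[ℝ] E) := by
    intro Z
    refine LinearMap.ext fun W => ?_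
    exact (adL_apply (G := G) Z W).symm
  refine (LieModule.traceForm_apply_apply ℝ (GroupLieAlgebra 𝓘(ℝ, E) G)
    (GroupLieAlgebra 𝓘(ℝ, E) G) X Y).trans ?_
  exact congrArg (LinearMap.trace ℝ E) (congrArg₂ (fun S T : E →ₗ[ℝ] E => S ∘ₗ T) (h X) (h Y))

theorem killE_bracketE [CompleteSpace E] (X Y Z : E) :
    killE G (bracketE G X Y) Z = killE G X (bracketE G Y Z) := by
  rw [← killingForm_eq_killE, ← killingForm_eq_killE]
  exact LieModule.traceForm_apply_lie_apply ℝ (GroupLieAlgebra 𝓘(ℝ, E) G)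
    (GroupLieAlgebra 𝓘(ℝ, E) G) X Y Z

/-- The velocity of a curve in a semisimple orbit is orthogonal to the centralizer. -/
theorem killE_velocity_eq_zero [CompleteSpace E] {f : ℝ[X]} (hf : f.Separable) {lam : E}
    (hlam : aeval (adL E G lam) f = 0) {c : ℝ → E} {v : E} {s : ℝ} (hc : HasDerivAt c v s)
    (horb : ∀ t, ∃ g : G, AdL E g lam = c t) {Z : E} (hZ : bracketE G Z (c s) = 0) :
    killE G v Z = 0 := by
  refine trace_mul_eq_zero_of_aeval_eq_zero hf ((adL E G).hasFDerivAt.comp_hasDerivAt s hc)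
    (fun t => ?_) (traceL E) traceL_mul_comm (commute_adL hZ)
  obtain ⟨g, hg⟩ := horb t
  rw [Function.comp_apply, ← hg]
  exact aeval_adL_AdL g lam f hlam

end KillingForm

/-! ### Semisimple orbits are closed. -/

section ClosedOrbit

variable {E : Type*} [NormedAddCommGroup E] [NormedSpace ℝ E] [FiniteDimensional ℝ E]
  {G : Type*} [TopologicalSpace G] [ChartedSpace E G] [Group G] [LieGroup 𝓘(ℝ, E) ∞ G]

/-- Near a semisimple element, the elements annihilated by the same separable polynomial are
conjugate to it. -/
theorem eventually_exists_AdL_eq (hinj : ∀ X : E, adL E G X = 0 → X = 0) {f : ℝ[X]}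
    (hf : f.Separable) {m : E} (hm : aeval (adL E G m) f = 0) :
    ∀ᶠ Y in 𝓝 m, aeval (adL E G Y) f = 0 → ∃ g : G, AdL E g m = Y := by
  have : CompleteSpace E := FiniteDimensional.complete ℝ E
  let N : Submodule ℝ E := LinearMap.ker (adL E G m : E →ₗ[ℝ] E)
  have : CompleteSpace N := FiniteDimensional.complete ℝ N
  -- A slice map: (x, Z) ↦ Ad(x)(m + Z) with Z in the centralizer of m. Its derivative (X, Z) ↦ [X,
  -- m] + Z is onto by `exists_range_add_ker`, so every Y near m has this form with Z small.
  let F : E × N → E := fun p => chartAd E G p.1 (m + p.2)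
  have hchart : chartAd E G (coordOne E G) = 1 := by
    rw [chartAd, chartOne_symm_coordOne, AdL_one]
    rfl
  have hF1 : ContDiffAt ℝ 1 F (coordOne E G, 0) := by
    refine ContDiffAt.clm_apply ?_ ?_
    · exact ContDiffAt.comp (coordOne E G, (0 : N)) (f := Prod.fst)
        (contDiffAt_chartAd (E := E) (G := G)) contDiffAt_fst
    · exact contDiffAt_const.add (N.subtypeL.contDiff.contDiffAt.comp _ contDiffAt_snd)
  have hA : HasFDerivAt (chartAd E G) (adL E G) (coordOne E G) :=
    ((contDiffAt_chartAd (E := E) (G := G)).differentiableAt (by simp)).hasFDerivAt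
  have hA' : HasFDerivAt (fun p : E × N => chartAd E G p.1)
      ((adL E G).comp (ContinuousLinearMap.fst ℝ E N)) (coordOne E G, 0) :=
    HasFDerivAt.comp (coordOne E G, (0 : N)) (f := Prod.fst) hA hasFDerivAt_fst
  have hB' : HasFDerivAt (fun p : E × N => m + (p.2 : E))
      (N.subtypeL.comp (ContinuousLinearMap.snd ℝ E N)) (coordOne E G, 0) :=
    (N.subtypeL.hasFDerivAt.comp (coordOne E G, (0 : N)) hasFDerivAt_snd).const_add m
  have hF2 := hA'.clm_apply hB'
  have hFs : HasStrictFDerivAt F (fderiv ℝ F (coordOne E G, 0)) (coordOne E G, 0) :=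
    hF1.hasStrictFDerivAt (by simp)
  have hFapply : ∀ (X : E) (Z : N), fderiv ℝ F (coordOne E G, 0) (X, Z) = bracketE G X m + Z := by
    intro X Z
    rw [show fderiv ℝ F (coordOne E G, 0) = _ from hF2.fderiv]
    simp [hchart, adL_apply, add_comm]
  have hsurj : (fderiv ℝ F (coordOne E G, 0) : E × N →ₗ[ℝ] E).range = ⊤ := by
    rw [LinearMap.range_eq_top]
    intro v
    obtain ⟨u, w, hw, huw⟩ := exists_range_add_ker (T := (adL E G m : E →ₗ[ℝ] E)) hf
      (by rw [aeval_toLinearMap, hm]; rfl) v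
    refine ⟨(-u, ⟨w, hw⟩), ?_⟩
    refine (hFapply _ _).trans ?_
    rw [bracketE_swap, ← adL_apply, map_neg, neg_neg]
    exact huw
  have hmap := hFs.map_nhds_eq_of_surj hsurj
  have hF0 : F (coordOne E G, 0) = m := by simp [F, hchart]
  rw [hF0] at hmap
  have hsmall : ∀ᶠ p : E × N in 𝓝 (coordOne E G, 0), Commute (adL E G (p.2 : E)) (adL E G m) →
      aeval (adL E G m + adL E G (p.2 : E)) f = 0 → adL E G (p.2 : E) = 0 := by
    have hcont : ContinuousAt (fun p : E × N => adL E G (p.2 : E)) (coordOne E G, 0) := by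
      fun_prop
    have h0 : Tendsto (fun p : E × N => adL E G (p.2 : E)) (𝓝 (coordOne E G, 0)) (𝓝 0) := by
      simpa [ContinuousAt] using hcont
    exact h0.eventually (eventually_eq_zero_of_commute hf hm)
  rw [← hmap, eventually_map]
  filter_upwards [hsmall] with p hp hY
  have hcomm : Commute (adL E G (p.2 : E)) (adL E G m) := by
    refine (commute_adL ?_).symm
    rw [← adL_apply]
    exact p.2.2
  -- Conjugating back, f(ad m + ad Z) = 0 with ad Z small and commuting with ad m; roots being
  -- isolated in that sense, ad Z = 0.
  have hZ := hp hcomm (by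
    have h1 := aeval_adL_AdL ((chartOne E G).symm p.1)⁻¹ _ f hY
    have h2 : AdL E ((chartOne E G).symm p.1)⁻¹ (F p) = m + p.2 := AdL_inv_apply_apply _ _
    rwa [h2, map_add] at h1)
  refine ⟨(chartOne E G).symm p.1, ?_⟩
  simp only [F, chartAd, hinj _ hZ, add_zero]

/-- Orbits of semisimple elements are closed. -/
theorem isClosed_orbit_AdL (hinj : ∀ X : E, adL E G X = 0 → X = 0) {f : ℝ[X]}
    (hf : f.Separable) {lam : E} (hlam : aeval (adL E G lam) f = 0) :
    IsClosed {Y : E | ∃ g : G, AdL E g lam = Y} := by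
  rw [← isOpen_compl_iff, isOpen_iff_mem_nhds]
  intro m hm
  have hcont : Continuous fun Y : E => aeval (adL E G Y) f := by
    have h1 : Continuous fun A : E →L[ℝ] E => aeval A f := by
      rw [continuous_iff_continuousAt]
      intro A
      obtain ⟨D, hD, -⟩ := exists_hasFDerivAt_aeval A f
      exact hD.continuousAt
    exact h1.comp (adL E G).continuous
  -- If m is a root, nearby orbit points are conjugate to m, which would put m in the orbit; if not,
  -- neither are nearby points, whereas all orbit points are roots.
  by_cases hmf : aeval (adL E G m) f = 0
  · filter_upwards [eventually_exists_AdL_eq hinj hf hmf] with Y hY hYorb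
    obtain ⟨g, rfl⟩ := hYorb
    obtain ⟨h, hh⟩ := hY (aeval_adL_AdL g lam f hlam)
    refine hm ⟨h⁻¹ * g, ?_⟩
    rw [AdL_mul, ContinuousLinearMap.comp_apply, ← hh, AdL_inv_apply_apply]
  · filter_upwards [hcont.continuousAt.eventually_ne hmf] with Y hY hYorb
    obtain ⟨g, rfl⟩ := hYorb
    exact hY (aeval_adL_AdL g lam f hlam)

end ClosedOrbit

end AdjointOrbit

namespace AdjointOrbit

open Polynomial

/-! ### Linear algebra of a Cartan decomposition. -/

section CartanDecomposition

variable {L : Type*} [LieRing L] [LieAlgebra ℝ L] {𝔨 𝔭 : Submodule ℝ L}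

namespace IsCartanDecomposition

variable (h : IsCartanDecomposition 𝔨 𝔭)

theorem projK_mem (X : L) : projK h X ∈ 𝔨 := Submodule.projection_apply_mem _ _

theorem projP_mem (X : L) : projP h X ∈ 𝔭 := Submodule.projection_apply_mem _ _

theorem projK_add_projP (X : L) : projK h X + projP h X = X :=
  Submodule.projection_add_projection_eq_self h.isCompl X

theorem projK_of_mem {X : L} (hX : X ∈ 𝔨) : projK h X = X :=
  Submodule.projection_apply_of_mem_left h.isCompl hX

theorem projK_of_mem_right {X : L} (hX : X ∈ 𝔭) : projK h X = 0 :=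
  Submodule.projection_apply_of_mem_right h.isCompl hX

theorem projP_of_mem {X : L} (hX : X ∈ 𝔭) : projP h X = X :=
  Submodule.projection_apply_of_mem_left h.isCompl.symm hX

theorem projP_of_mem_left {X : L} (hX : X ∈ 𝔨) : projP h X = 0 :=
  Submodule.projection_apply_of_mem_right h.isCompl.symm hX

theorem projK_lie {X : L} (hX : X ∈ 𝔨) (Y : L) : projK h ⁅X, Y⁆ = ⁅X, projK h Y⁆ := by
  conv_lhs => rw [← h.projK_add_projP Y, lie_add, map_add]
  rw [h.projK_of_mem (h.lie_kk X hX _ (h.projK_mem Y)),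
    h.projK_of_mem_right (h.lie_kp X hX _ (h.projP_mem Y)), add_zero]

theorem projP_lie {X : L} (hX : X ∈ 𝔨) (Y : L) : projP h ⁅X, Y⁆ = ⁅X, projP h Y⁆ := by
  conv_lhs => rw [← h.projK_add_projP Y, lie_add, map_add]
  rw [h.projP_of_mem_left (h.lie_kk X hX _ (h.projK_mem Y)),
    h.projP_of_mem (h.lie_kp X hX _ (h.projP_mem Y)), zero_add]

/-- The two summands of a Cartan decomposition are orthogonal for the Killing form. -/
theorem killingForm_eq_zero (h : IsCartanDecomposition 𝔨 𝔭) {X Y : L} (hX : X ∈ 𝔨) (hY : Y ∈ 𝔭) : killingForm ℝ L X Y = 0 := by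
  -- The Cartan involution is a Lie algebra automorphism, so it preserves B; being 1 on 𝔨 and -1 on
  -- 𝔭, it forces B(X, Y) = -B(X, Y).
  let θ : L →ₗ[ℝ] L := projK h - projP h
  have hθ : ∀ Z, θ Z = projK h Z - projP h Z := fun Z => rfl
  have hinv : ∀ Z, θ (θ Z) = Z := by
    intro Z
    rw [hθ Z, hθ, map_sub, map_sub, h.projK_of_mem (h.projK_mem Z),
      h.projK_of_mem_right (h.projP_mem Z), h.projP_of_mem (h.projP_mem Z),
      h.projP_of_mem_left (h.projK_mem Z), sub_zero, zero_sub, sub_neg_eq_add, h.projK_add_projP]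
  have hlie : ∀ Z W, θ ⁅Z, W⁆ = ⁅θ Z, θ W⁆ := by
    intro Z W
    have hK := h.projK_mem
    have hP := h.projP_mem
    have hpk : ∀ A ∈ 𝔭, ∀ B ∈ 𝔨, ⁅A, B⁆ ∈ 𝔭 := by
      intro A hA B hB
      rw [← lie_skew]
      exact 𝔭.neg_mem (h.lie_kp B hB A hA)
    have h1 : ⁅Z, W⁆ = (⁅projK h Z, projK h W⁆ + ⁅projP h Z, projP h W⁆) +
        (⁅projK h Z, projP h W⁆ + ⁅projP h Z, projK h W⁆) := by
      conv_lhs => rw [← h.projK_add_projP Z, ← h.projK_add_projP W]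
      simp only [add_lie, lie_add]
      abel
    have h2 := 𝔨.add_mem (h.lie_kk _ (hK Z) _ (hK W)) (h.lie_pp _ (hP Z) _ (hP W))
    have h3 := 𝔭.add_mem (h.lie_kp _ (hK Z) _ (hP W)) (hpk _ (hP Z) _ (hK W))
    rw [h1, hθ, map_add (projK h), map_add (projP h), h.projK_of_mem h2,
      h.projK_of_mem_right h3, h.projP_of_mem h3, h.projP_of_mem_left h2, hθ, hθ]
    simp only [sub_lie, lie_sub]
    abel
  let e : L ≃ₗ⁅ℝ⁆ L :=
    { θ with
      map_lie' := fun {Z W} => hlie Z W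
      invFun := θ
      left_inv := hinv
      right_inv := hinv }
  have h1 := LieAlgebra.killingForm_of_equiv_apply e X Y
  have hX' : e X = X := by
    change θ X = X
    rw [hθ, h.projK_of_mem hX, h.projP_of_mem_left hX, sub_zero]
  have hY' : e Y = -Y := by
    change θ Y = -Y
    rw [hθ, h.projK_of_mem_right hY, h.projP_of_mem hY, zero_sub]
  rw [hX', hY', map_neg] at h1
  linarith

/-- The Euclidean inner product of a Cartan decomposition. -/
noncomputable def inner : LinearMap.BilinForm ℝ L :=
  -(killingForm ℝ L).compl₁₂ (projK h) (projK h) + (killingForm ℝ L).compl₁₂ (projP h) (projP h)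

theorem inner_apply (X Y : L) : h.inner X Y =
    -killingForm ℝ L (projK h X) (projK h Y) + killingForm ℝ L (projP h X) (projP h Y) := rfl

theorem inner_comm (X Y : L) : h.inner X Y = h.inner Y X := by
  rw [inner_apply, inner_apply, LieModule.traceForm_comm ℝ L L (projK h X),
    LieModule.traceForm_comm ℝ L L (projP h X)]

theorem inner_nonneg (X : L) : 0 ≤ h.inner X X := by
  rw [inner_apply]
  have h1 : killingForm ℝ L (projK h X) (projK h X) ≤ 0 := by
    by_cases h0 : projK h X = 0
    · simp [h0]
    · exact (h.neg_def _ (h.projK_mem X) h0).le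
  have h2 : 0 ≤ killingForm ℝ L (projP h X) (projP h X) := by
    by_cases h0 : projP h X = 0
    · simp [h0]
    · exact (h.pos_def _ (h.projP_mem X) h0).le
  linarith

theorem inner_pos {X : L} (hX : X ≠ 0) : 0 < h.inner X X := by
  have hn1 : ∀ Y ∈ 𝔨, killingForm ℝ L Y Y ≤ 0 := fun Y hY => by
    by_cases h0 : Y = 0
    · simp [h0]
    · exact (h.neg_def _ hY h0).le
  have hn2 : ∀ Y ∈ 𝔭, 0 ≤ killingForm ℝ L Y Y := fun Y hY => by
    by_cases h0 : Y = 0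
    · simp [h0]
    · exact (h.pos_def _ hY h0).le
  rw [inner_apply]
  have h1 := hn1 _ (h.projK_mem X)
  have h2 := hn2 _ (h.projP_mem X)
  by_cases h0 : projK h X = 0
  · have h3 : projP h X ≠ 0 := fun h4 => hX (by rw [← h.projK_add_projP X, h0, h4, add_zero])
    have := h.pos_def _ (h.projP_mem X) h3
    linarith
  · have := h.neg_def _ (h.projK_mem X) h0
    linarith

theorem cartanNorm_sq (X : L) : cartanNorm h X ^ 2 = h.inner X X :=
  Real.sq_sqrt (h.inner_nonneg X)

theorem inner_sq_le (X Y : L) : h.inner X Y ^ 2 ≤ h.inner X X * h.inner Y Y := by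
  have h1 := LinearMap.BilinForm.apply_mul_apply_le_of_forall_zero_le h.inner h.inner_nonneg X Y
  rw [h.inner_comm Y X] at h1
  nlinarith

theorem inner_of_mem {X : L} (hX : X ∈ 𝔨) (Y : L) : h.inner X Y = -killingForm ℝ L X Y := by
  rw [inner_apply, h.projK_of_mem hX, h.projP_of_mem_left hX]
  conv_rhs => rw [← h.projK_add_projP Y, map_add, h.killingForm_eq_zero hX (h.projP_mem Y)]
  simp

theorem killingForm_projK {X : L} (hX : X ∈ 𝔨) (Y : L) :
    killingForm ℝ L X (projK h Y) = killingForm ℝ L X Y := by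
  conv_rhs => rw [← h.projK_add_projP Y, map_add, h.killingForm_eq_zero hX (h.projP_mem Y)]
  simp

/-- Since B(X, X) is constant on orbits, bounding a point of M reduces to bounding its projection to
𝔨. -/
theorem inner_self_eq (X : L) :
    h.inner X X = 2 * h.inner (projK h X) (projK h X) + killingForm ℝ L X X := by
  have h1 : killingForm ℝ L X X = killingForm ℝ L (projK h X) (projK h X) +
      killingForm ℝ L (projP h X) (projP h X) := by
    have h2 := LieModule.traceForm_comm ℝ L L (projP h X) (projK h X)
    have h3 := h.killingForm_eq_zero (h.projK_mem X) (h.projP_mem X)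
    conv_lhs => rw [← h.projK_add_projP X]
    simp only [map_add, LinearMap.add_apply]
    linarith
  rw [h.inner_of_mem (h.projK_mem X), inner_apply, h1]
  ring

theorem eq_zero_of_killingForm (h : IsCartanDecomposition 𝔨 𝔭) {X : L} (hX : ∀ Y, killingForm ℝ L X Y = 0) : X = 0 := by
  by_contra hne
  refine (h.inner_pos hne).ne' ?_
  have h1 := h.killingForm_projK (h.projK_mem X) X
  have h2 := hX (projK h X)
  have h3 := hX (projP h X)
  have h4 : killingForm ℝ L (projP h X) (projP h X) = 0 := by
    have h5 := congrArg (fun Y => killingForm ℝ L Y (projP h X)) (h.projK_add_projP X)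
    simp only [map_add, LinearMap.add_apply] at h5
    linarith [h.killingForm_eq_zero (h.projK_mem X) (h.projP_mem X)]
  rw [inner_apply, h1, h4, LieModule.traceForm_comm ℝ L L (projK h X) X, h2]
  simp

/-- The elements of the compact summand are semisimple. -/
theorem exists_separable [FiniteDimensional ℝ L] (h : IsCartanDecomposition 𝔨 𝔭) {X : L} (hX : X ∈ 𝔨) :
    ∃ f : ℝ[X], f.Separable ∧ aeval (LieAlgebra.ad ℝ L X) f = 0 := by
  -- ad X preserves both summands and B is invariant, so ad X is skew for the Euclidean product.
  refine exists_separable_of_skew h.inner ⟨fun Y Z => h.inner_comm Y Z⟩ (fun Y => h.inner_pos)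
    fun Y Z => ?_
  rw [LieAlgebra.ad_apply, LieAlgebra.ad_apply, inner_apply, inner_apply, h.projK_lie hX,
    h.projP_lie hX, h.projK_lie hX, h.projP_lie hX]
  rw [LieModule.traceForm_apply_lie_apply', LieModule.traceForm_apply_lie_apply']
  ring

/-- An element `m` of the orbit of `lam` whose component in the compact summand is close to some
`a` in the compact summand is bounded, if `a` is conjugate to `a'` by the same group element. -/
theorem inner_self_le {lam m a a' : L} {R : ℝ} (hlam : lam ∈ 𝔨) (ha : a ∈ 𝔨) (ha' : a' ∈ 𝔨)
    (hmm : killingForm ℝ L m m = killingForm ℝ L lam lam)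
    (hma : killingForm ℝ L m a = killingForm ℝ L lam a')
    (haa : killingForm ℝ L a a = killingForm ℝ L a' a')
    (hR : h.inner (projK h m - a) (projK h m - a) ≤ R) :
    h.inner m m ≤ h.inner lam lam + 2 * R := by
  set u := projK h m with hu
  have hP : h.inner u a = h.inner lam a' := by
    rw [h.inner_comm, h.inner_of_mem ha, h.inner_of_mem hlam, h.killingForm_projK ha,
      LieModule.traceForm_comm, hma]
  have hQ : h.inner a a = h.inner a' a' := by rw [h.inner_of_mem ha, h.inner_of_mem ha', haa]
  have hL : killingForm ℝ L m m = -h.inner lam lam := by rw [hmm, h.inner_of_mem hlam, neg_neg]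
  have hexp : h.inner (u - a) (u - a) = h.inner u u - 2 * h.inner u a + h.inner a a := by
    simp only [map_sub, LinearMap.sub_apply, h.inner_comm a u]
    ring
  have hCS := h.inner_sq_le lam a'
  rw [← hP, ← hQ] at hCS
  -- Here ‖u‖² = ‖u - a‖² + 2⟨u, a⟩ - ‖a‖² and ⟨u, a⟩ ≤ ‖lam‖‖a‖, so the claim is 2xy - y² ≤ x²
  -- written without square roots; a of norm zero is treated apart.
  have hU : h.inner u u ≤ h.inner lam lam + R := by
    rcases (h.inner_nonneg a).eq_or_lt with h0 | h0
    · have hl := h.inner_nonneg lam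
      rw [← h0, mul_zero] at hCS
      have hP0 : h.inner u a = 0 := by nlinarith
      linarith
    · by_contra hcon
      have h1 : h.inner lam lam < 2 * h.inner u a - h.inner a a := by linarith
      nlinarith [sq_nonneg (h.inner u a - h.inner a a)]
  rw [h.inner_self_eq m, ← hu, hL]
  linarith

end IsCartanDecomposition

end CartanDecomposition

end AdjointOrbit

namespace AdjointOrbit

open Filter Topology Polynomial

/-! ### The compact summand: K-invariance and the centralizer of λ. -/

section CompactSummand

variable {E : Type*} [NormedAddCommGroup E] [NormedSpace ℝ E]
  {G : Type*} [TopologicalSpace G] [ChartedSpace E G] [Group G]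

theorem mem_orbit_iff (K : Subgroup G) (X Y : E) :
    Y ∈ orbit (E := E) K X ↔ ∃ g ∈ K, AdL E g X = Y := Iff.rfl

variable [LieGroup 𝓘(ℝ, E) ∞ G]

theorem isCompact_orbit {K : Subgroup G} {μ : E} (hK : IsCompact (K : Set G)) :
    IsCompact {Y : E | Y ∈ orbit (E := E) K μ} := by
  have h1 : Continuous fun g : G => AdL E g μ := continuous_AdL.clm_apply continuous_const
  have h2 := hK.image h1
  exact h2

variable {𝔨 𝔭 : Submodule ℝ (GroupLieAlgebra 𝓘(ℝ, E) G)}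

theorem AdL_mem_of_mem {K : Subgroup G} (h𝔨 : (𝔨 : Set (GroupLieAlgebra 𝓘(ℝ, E) G)) = lieAlgebraOf E K) {k : G}
    (hk : k ∈ K) {X : E} (hX : X ∈ 𝔨) : AdL E k X ∈ 𝔨 := by
  have hX' : X ∈ lieAlgebraOf E K := h𝔨 ▸ hX
  obtain ⟨c, hcK, hc0, hc, hcX⟩ := hX'
  obtain ⟨hd, hv⟩ := velocity_conj hc0 hc k
  have : AdL E k X ∈ lieAlgebraOf E K :=
    ⟨fun t => k * c t * k⁻¹, fun t => K.mul_mem (K.mul_mem hk (hcK t)) (K.inv_mem hk),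
      by simp [hc0], hd, hv.trans (congrArg (AdL E k) hcX)⟩
  exact (Set.ext_iff.1 h𝔨 _).2 this

variable [CompleteSpace E]

/-- The centralizer of a regular elliptic element is contained in the compact summand. -/
theorem mem_of_bracketE_eq_zero [T2Space G] {K : Subgroup G}
    (h𝔨 : (𝔨 : Set (GroupLieAlgebra 𝓘(ℝ, E) G)) = lieAlgebraOf E K) {lam : E} (hreg : IsRegularElliptic (E := E) K lam)
    {X : E} (hX : bracketE G X lam = 0) : X ∈ 𝔨 := by
  obtain ⟨T, hT, hstab⟩ := hreg
  obtain ⟨c, hc, hc0, hcd, hcX⟩ := exists_curve_of_bracketE_eq_zero hX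
  have : X ∈ lieAlgebraOf E K := by
    refine ⟨c, fun t => hT.prop.1 ?_, hc0, hcd, hcX⟩
    have : c t ∈ stab (E := E) lam := hc t
    rw [hstab] at this
    exact this
  exact (Set.ext_iff.1 h𝔨 _).2 this

theorem eq_zero_of_killE (h : IsCartanDecomposition 𝔨 𝔭) {X : E} (hX : ∀ Y, killE G X Y = 0) :
    X = 0 :=
  h.eq_zero_of_killingForm fun Y => (killingForm_eq_killE X Y).trans (hX Y)

theorem eq_zero_of_adL_eq_zero (h : IsCartanDecomposition 𝔨 𝔭) {X : E} (hX : adL E G X = 0) :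
    X = 0 :=
  eq_zero_of_killE h fun Y => by rw [killE, hX, zero_mul, map_zero]

end CompactSummand

/-! ### Critical points of the norm square of the moment map. -/

section SemisimpleGroup

variable {E : Type*} [NormedAddCommGroup E] [NormedSpace ℝ E] [FiniteDimensional ℝ E]
  [CompleteSpace E]
  {G : Type*} [TopologicalSpace G] [ChartedSpace E G] [Group G] [LieGroup 𝓘(ℝ, E) ∞ G]
  {𝔨 𝔭 : Submodule ℝ (GroupLieAlgebra 𝓘(ℝ, E) G)}

/-- The inner product of a Cartan decomposition, as a continuous bilinear form on the model
space. -/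
noncomputable def innerL (h : IsCartanDecomposition 𝔨 𝔭) : E →L[ℝ] E →L[ℝ] ℝ :=
  LinearMap.toContinuousBilinearMap (h.inner : E →ₗ[ℝ] E →ₗ[ℝ] ℝ)

theorem innerL_apply (h : IsCartanDecomposition 𝔨 𝔭) (X Y : E) :
    innerL h X Y = h.inner X Y := rfl

/-- The projection to the compact summand, as a continuous linear map on the model space. -/
noncomputable def projKL (h : IsCartanDecomposition 𝔨 𝔭) : E →L[ℝ] E :=
  LinearMap.toContinuousLinearMap (projK h : E →ₗ[ℝ] E)

theorem innerL_of_mem (h : IsCartanDecomposition 𝔨 𝔭) {X : E} (hX : X ∈ 𝔨) (Y : E) :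
    innerL h X Y = -killE G X Y := by
  rw [innerL_apply, ← killingForm_eq_killE]
  exact h.inner_of_mem hX Y

theorem killE_projKL (h : IsCartanDecomposition 𝔨 𝔭) {X : E} (hX : X ∈ 𝔨) (Y : E) :
    killE G X (projKL h Y) = killE G X Y := by
  rw [← killingForm_eq_killE, ← killingForm_eq_killE]
  exact h.killingForm_projK hX Y

theorem exists_separable_adL (h : IsCartanDecomposition 𝔨 𝔭) {X : E} (hX : X ∈ 𝔨) :
    ∃ f : ℝ[X], f.Separable ∧ aeval (adL E G X) f = 0 := by
  have : FiniteDimensional ℝ (GroupLieAlgebra 𝓘(ℝ, E) G) := inferInstanceAs (FiniteDimensional ℝ E)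
  obtain ⟨f, hf, hfX⟩ := h.exists_separable hX
  refine ⟨f, hf, ?_⟩
  have h1 : (LieAlgebra.ad ℝ (GroupLieAlgebra 𝓘(ℝ, E) G) X : E →ₗ[ℝ] E) =
      (adL E G X : E →ₗ[ℝ] E) :=
    LinearMap.ext fun W => (adL_apply (G := G) X W).symm
  have h2 : aeval (adL E G X : E →ₗ[ℝ] E) f = 0 := by
    rw [← h1]
    exact hfX
  rw [aeval_toLinearMap] at h2
  ext W
  exact congrArg (fun T : E →ₗ[ℝ] E => T W) h2

/-- The derivative of the norm square of the moment map. -/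
theorem hasDerivAt_cartanNorm_sq (h : IsCartanDecomposition 𝔨 𝔭) {t : ℝ} {c₁ c₂ : ℝ → E} {v w : E}
    (h₁ : HasDerivAt c₁ v 0) (h₂ : HasDerivAt c₂ w 0) (hc₂ : c₂ 0 ∈ 𝔨) :
    HasDerivAt (fun s => cartanNorm h (projKL h (c₁ s) - t • c₂ s) ^ 2)
      (2 * (t * killE G (projKL h (c₁ 0) - t • c₂ 0) w -
        killE G (projKL h (c₁ 0) - t • c₂ 0) v)) 0 := by
  have ha : projKL h (c₁ 0) - t • c₂ 0 ∈ 𝔨 :=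
    𝔨.sub_mem (h.projK_mem (c₁ 0)) (𝔨.smul_mem t hc₂)
  have hw : HasDerivAt (fun s => projKL h (c₁ s) - t • c₂ s) (projKL h v - t • w) 0 :=
    ((projKL h).hasFDerivAt.comp_hasDerivAt (0 : ℝ) h₁).sub (h₂.const_smul t)
  have hq := ((innerL h).hasFDerivAt.comp_hasDerivAt (0 : ℝ) hw).clm_apply hw
  have hval : ∀ s, cartanNorm h (projKL h (c₁ s) - t • c₂ s) ^ 2 =
      innerL h (projKL h (c₁ s) - t • c₂ s) (projKL h (c₁ s) - t • c₂ s) :=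
    fun s => h.cartanNorm_sq _
  simp only [hval]
  have hsymm : ∀ X Y : E, innerL h X Y = innerL h Y X := fun X Y => h.inner_comm X Y
  refine hq.congr_deriv ?_
  simp only [Function.comp_apply]
  -- As a lies in 𝔨, pairing with it is -B(a, ·), and the projection of v to 𝔨 can be dropped.
  rw [hsymm (projKL h v - t • w), map_sub, map_smul, innerL_of_mem h ha, innerL_of_mem h ha,
    killE_projKL h ha]
  simp only [smul_eq_mul]
  ring

/-- The Euclidean product dominates the given norm, κ being its minimum on the unit sphere (empty
only if E = 0). -/
theorem isCompact_setOf_inner_le (h : IsCartanDecomposition 𝔨 𝔭) (C : ℝ) :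
    IsCompact {X : E | innerL h X X ≤ C} := by
  have hpos : ∀ X : E, X ≠ 0 → 0 < innerL h X X := fun X hX => h.inner_pos hX
  have hcont : Continuous fun X : E => innerL h X X := by fun_prop
  obtain ⟨κ, hκ, hκle⟩ : ∃ κ : ℝ, 0 < κ ∧ ∀ X : E, κ * ‖X‖ ^ 2 ≤ innerL h X X := by
    have : ProperSpace E := FiniteDimensional.proper ℝ E
    rcases (Metric.sphere (0 : E) 1).eq_empty_or_nonempty with h0 | h0
    · refine ⟨1, one_pos, fun X => ?_⟩
      have hX : X = 0 := by
        by_contra hne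
        have : ‖X‖⁻¹ • X ∈ Metric.sphere (0 : E) 1 := by simp [norm_smul, hne]
        simp [h0] at this
      simp [hX]
    · obtain ⟨X₀, hX₀, hmin⟩ := (isCompact_sphere (0 : E) 1).exists_isMinOn h0 hcont.continuousOn
      have hX₀1 : ‖X₀‖ = 1 := by simpa using hX₀
      refine ⟨innerL h X₀ X₀, hpos X₀ (norm_ne_zero_iff.1 (by simp [hX₀1])), fun X => ?_⟩
      by_cases hX : X = 0
      · simp [hX]
      have hn : ‖X‖ ≠ 0 := norm_ne_zero_iff.2 hX
      have h1 : innerL h X₀ X₀ ≤ innerL h (‖X‖⁻¹ • X) (‖X‖⁻¹ • X) :=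
        hmin (by simp [norm_smul, hX] : ‖X‖⁻¹ • X ∈ Metric.sphere (0 : E) 1)
      simp only [map_smul, smul_apply, smul_eq_mul] at h1
      calc innerL h X₀ X₀ * ‖X‖ ^ 2
          ≤ ‖X‖⁻¹ * (‖X‖⁻¹ * innerL h X X) * ‖X‖ ^ 2 :=
            mul_le_mul_of_nonneg_right h1 (by positivity)
        _ = innerL h X X := by field_simp
  have : ProperSpace E := FiniteDimensional.proper ℝ E
  refine Metric.isCompact_of_isClosed_isBounded (isClosed_le hcont continuous_const) ?_
  refine (Metric.isBounded_closedBall (x := (0 : E)) (r := √(C / κ))).subset fun X hX => ?_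
  rw [mem_closedBall_zero_iff]
  refine Real.le_sqrt_of_sq_le ?_
  rw [le_div_iff₀ hκ, mul_comm]
  exact (hκle X).trans hX

variable {K : Subgroup G} {lam μ : E} {t : ℝ}

theorem bracketE_eq_zero_of_mem_momentCr (h : IsCartanDecomposition 𝔨 𝔭)
    (h𝔨 : (𝔨 : Set (GroupLieAlgebra 𝓘(ℝ, E) G)) = lieAlgebraOf E K) (hμ : μ ∈ 𝔨)
    {m n : E} (hm : m ∈ orbit (E := E) (⊤ : Subgroup G) lam) (hn : n ∈ orbit (E := E) K μ)
    (hp : ⟨(m, n), hm, hn⟩ ∈ momentCr h K lam μ t) :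
    bracketE G (projKL h m - t • n) m = 0 ∧
      t • bracketE G (projKL h m - t • n) n = 0 := by
  obtain ⟨k, hk, hkn⟩ := (mem_orbit_iff K μ n).1 hn
  obtain ⟨g, -, hgm⟩ := (mem_orbit_iff ⊤ lam m).1 hm
  have hn𝔨 : n ∈ 𝔨 := hkn ▸ AdL_mem_of_mem h𝔨 hk hμ
  set a : E := projKL h m - t • n with ha
  have ha𝔨 : a ∈ 𝔨 := 𝔨.sub_mem (h.projK_mem m) (𝔨.smul_mem t hn𝔨)
  constructor
  · refine eq_zero_of_killE h fun X => ?_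
    obtain ⟨c, hc0, hc, hcX⟩ := exists_curve (G := G) X
    have h₁ : HasDerivAt (fun s => AdL E (c s) m) (bracketE G X m) 0 := by
      simpa only [hcX] using hasDerivAt_AdL hc0 hc m
    have h₂ : HasDerivAt (fun _ : ℝ => n) 0 0 := hasDerivAt_const _ _
    have h3 := hasDerivAt_cartanNorm_sq h (t := t) h₁ h₂ hn𝔨
    have h4 := hp (fun s => ⟨(AdL E (c s) m, n), ⟨c s * g, trivial, by
      rw [← AdL_apply, AdL_mul, ← hgm]; rfl⟩, hn⟩) (by
        refine Subtype.ext (Prod.ext ?_ rfl)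
        simp only [hc0, AdL_one]
        rfl) (h₁.prodMk h₂).differentiableAt
    have h5 := h3.unique h4
    simp only [hc0, AdL_one, ContinuousLinearMap.id_apply, ← ha] at h5
    have h6 : killE G a 0 = 0 := by simp [killE]
    rw [h6, bracketE_swap, killE, map_neg, mul_neg, map_neg] at h5
    rw [killE_bracketE, killE]
    linarith
  -- The variation of n is generated by [a, n] itself: B(a, [[a, n], n]) = -B([a, n], [a, n]), which
  -- is definite on 𝔨.
  · have hmem : bracketE G a n ∈ 𝔨 := h.lie_kk a ha𝔨 n hn𝔨
    have hmem' : bracketE G a n ∈ lieAlgebraOf E K := h𝔨 ▸ hmem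
    obtain ⟨c, hcK, hc0, hc, hcX⟩ := hmem'
    replace hcX : velocity c 0 = bracketE G a n := hcX
    have h₁ : HasDerivAt (fun _ : ℝ => m) 0 0 := hasDerivAt_const _ _
    have h₂ : HasDerivAt (fun s => AdL E (c s) n) (bracketE G (bracketE G a n) n) 0 := by
      simpa only [hcX] using hasDerivAt_AdL hc0 hc n
    have h3 := hasDerivAt_cartanNorm_sq h (t := t) h₁ h₂ (by
        rw [hc0, AdL_one]
        exact hn𝔨)
    have h4 := hp (fun s => ⟨(m, AdL E (c s) n), hm, ⟨c s * k, K.mul_mem (hcK s) hk, by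
      rw [← AdL_apply, AdL_mul, ← hkn]; rfl⟩⟩) (by
        refine Subtype.ext (Prod.ext rfl ?_)
        simp only [hc0, AdL_one]
        rfl) (h₁.prodMk h₂).differentiableAt
    have h5 := h3.unique h4
    simp only [hc0, AdL_one, ContinuousLinearMap.id_apply, ← ha] at h5
    have h6 : killE G a 0 = 0 := by simp [killE]
    have h7 : killE G a (bracketE G (bracketE G a n) n) =
        -killE G (bracketE G a n) (bracketE G a n) := by
      rw [bracketE_swap, killE, map_neg, mul_neg, map_neg, killE_bracketE]
      rfl
    rw [h6, h7] at h5
    by_cases ht : t = 0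
    · rw [ht, zero_smul]
    · by_contra hne
      have h8 := h.neg_def _ hmem (fun h0 => hne (by
        rw [show bracketE G a n = 0 from h0, smul_zero]))
      rw [killingForm_eq_killE] at h8
      have h9 : t * killE G (bracketE G a n) (bracketE G a n) = 0 := by linarith
      rcases mul_eq_zero.1 h9 with h10 | h10
      · exact ht h10
      · exact h8.ne h10

/-- Criticality tests every differentiable curve in the product, whatever its velocity. Since a
centralizes m and n, `killE_velocity_eq_zero` makes it B-orthogonal to both velocity components. -/
theorem mem_momentCr_of_bracketE_eq_zero (h : IsCartanDecomposition 𝔨 𝔭)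
    (h𝔨 : (𝔨 : Set (GroupLieAlgebra 𝓘(ℝ, E) G)) = lieAlgebraOf E K) (hlam : lam ∈ 𝔨) (hμ : μ ∈ 𝔨)
    {m n : E} (hm : m ∈ orbit (E := E) (⊤ : Subgroup G) lam) (hn : n ∈ orbit (E := E) K μ)
    (h1 : bracketE G (projKL h m - t • n) m = 0)
    (h2 : bracketE G (projKL h m - t • n) n = 0) :
    ⟨(m, n), hm, hn⟩ ∈ momentCr h K lam μ t := by
  intro c hc0 hc
  let c₁ : ℝ → E := fun s => (c s).1.1
  let c₂ : ℝ → E := fun s => (c s).1.2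
  have hc₁0 : c₁ 0 = m := congrArg (fun q => q.1.1) hc0
  have hc₂0 : c₂ 0 = n := congrArg (fun q => q.1.2) hc0
  have hc' : DifferentiableAt ℝ (fun s => ((c₁ s, c₂ s) : E × E)) 0 := hc
  have h₁ : HasDerivAt c₁ (deriv c₁ 0) 0 := hc'.fst.hasDerivAt
  have h₂ : HasDerivAt c₂ (deriv c₂ 0) 0 := hc'.snd.hasDerivAt
  obtain ⟨f, hf, hflam⟩ := exists_separable_adL h hlam
  obtain ⟨f', hf', hfμ⟩ := exists_separable_adL h hμ
  have hk₁ := killE_velocity_eq_zero hf hflam h₁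
    (fun s => by obtain ⟨g, -, hg⟩ := (c s).2.1; exact ⟨g, hg⟩) (by rw [hc₁0]; exact h1)
  have hk₂ := killE_velocity_eq_zero hf' hfμ h₂
    (fun s => by obtain ⟨g, -, hg⟩ := (c s).2.2; exact ⟨g, hg⟩) (by rw [hc₂0]; exact h2)
  have hn𝔨 : c₂ 0 ∈ 𝔨 := by
    obtain ⟨k, hk, hkn⟩ := (c 0).2.2
    exact Set.mem_of_eq_of_mem hkn.symm (AdL_mem_of_mem h𝔨 hk hμ)
  have h3 := hasDerivAt_cartanNorm_sq h (t := t) h₁ h₂ hn𝔨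
  rw [killE_comm, killE_comm _ (deriv c₁ 0), hc₁0, hc₂0, hk₁, hk₂, mul_zero, sub_zero,
    mul_zero] at h3
  exact h3

/-- The bound on the critical points of the norm square of the moment map. -/
theorem inner_le_of_mem_momentCr [T2Space G] (h : IsCartanDecomposition 𝔨 𝔭)
    (h𝔨 : (𝔨 : Set (GroupLieAlgebra 𝓘(ℝ, E) G)) = lieAlgebraOf E K) (hlam : lam ∈ 𝔨)
    (hreg : IsRegularElliptic (E := E) K lam) (hμ : μ ∈ 𝔨)
    {m n : E} (hm : m ∈ orbit (E := E) (⊤ : Subgroup G) lam) (hn : n ∈ orbit (E := E) K μ)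
    (hp : ⟨(m, n), hm, hn⟩ ∈ momentCr h K lam μ t) :
    innerL h m m ≤ innerL h lam lam + 2 * (t ^ 2 * innerL h μ μ) := by
  have h1 := (bracketE_eq_zero_of_mem_momentCr h h𝔨 hμ hm hn hp).1
  obtain ⟨k, hk, hkn⟩ := (mem_orbit_iff K μ n).1 hn
  obtain ⟨g, -, hgm⟩ := (mem_orbit_iff ⊤ lam m).1 hm
  have hn𝔨 : n ∈ 𝔨 := hkn ▸ AdL_mem_of_mem h𝔨 hk hμ
  set a : E := projKL h m - t • n with ha
  have ha𝔨 : a ∈ 𝔨 := 𝔨.sub_mem (h.projK_mem m) (𝔨.smul_mem t hn𝔨)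
  -- Regularity enters here: g⁻¹·a centralizes lam, and that centralizer lies in 𝔨.
  have ha' : AdL E g⁻¹ a ∈ 𝔨 := by
    refine mem_of_bracketE_eq_zero h𝔨 hreg ?_
    have h2 : lam = AdL E g⁻¹ m := by rw [← hgm, AdL_inv_apply_apply]
    rw [h2, bracketE_AdL, h1, map_zero]
  have hkill : ∀ X Y : E, killingForm ℝ (GroupLieAlgebra 𝓘(ℝ, E) G) X Y =
      killingForm ℝ (GroupLieAlgebra 𝓘(ℝ, E) G) (AdL E g⁻¹ X) (AdL E g⁻¹ Y) := by
    intro X Y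
    rw [killingForm_eq_killE, killingForm_eq_killE, killE_AdL]
  have hglam : AdL E g⁻¹ m = lam := by rw [← hgm, AdL_inv_apply_apply]
  refine h.inner_self_le hlam ha𝔨 ha' ?_ ?_ (hkill a a) ?_
  · rw [hkill m m, hglam]
  · rw [hkill m a, hglam]
  · have h3 : (projKL h m - a : E) = t • n := by rw [ha]; abel
    have h4 : innerL h n n = innerL h μ μ := by
      rw [innerL_of_mem h hn𝔨, innerL_of_mem h hμ, ← hkn, killE_AdL]
    refine le_of_eq ?_
    change innerL h (projKL h m - a) (projKL h m - a) = _
    rw [h3, map_smul, map_smul, smul_apply, h4, smul_eq_mul, smul_eq_mul]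
    ring

theorem isClosed_orbit_top (h : IsCartanDecomposition 𝔨 𝔭) (hlam : lam ∈ 𝔨) :
    IsClosed {Y : E | Y ∈ orbit (E := E) (⊤ : Subgroup G) lam} := by
  obtain ⟨f, hf, hflam⟩ := exists_separable_adL h hlam
  have h1 := isClosed_orbit_AdL (fun X => eq_zero_of_adL_eq_zero h) hf hflam
  convert h1 using 2
  ext Y
  simp [mem_orbit_iff]

theorem isCompact_orbit_inter (h : IsCartanDecomposition 𝔨 𝔭) (hlam : lam ∈ 𝔨) (C : ℝ) :
    IsCompact {Y : E | Y ∈ orbit (E := E) (⊤ : Subgroup G) lam ∧ innerL h Y Y ≤ C} :=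
  (isCompact_setOf_inner_le h C).inter_left (isClosed_orbit_top h hlam)

/-- At t = 1 the two bracket equations characterize critical points. They are closed conditions,
imposed on the compact product of a bounded piece of M with K·μ. -/
theorem isCompact_momentCr_one [T2Space G] (h : IsCartanDecomposition 𝔨 𝔭)
    (hK : IsCompact (K : Set G)) (h𝔨 : (𝔨 : Set (GroupLieAlgebra 𝓘(ℝ, E) G)) = lieAlgebraOf E K) (hlam : lam ∈ 𝔨)
    (hreg : IsRegularElliptic (E := E) K lam) (hμ : μ ∈ 𝔨) :
    IsCompact (momentCr h K lam μ 1) := by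
  set C := innerL h lam lam + 2 * (1 ^ 2 * innerL h μ μ)
  have hprod := (isCompact_orbit_inter (G := G) h hlam C).prod
    (isCompact_orbit (E := E) (μ := μ) hK)
  have hcl : IsClosed {q : E × E | adL E G (projKL h q.1 - (1 : ℝ) • q.2) q.1 = 0 ∧
      adL E G (projKL h q.1 - (1 : ℝ) • q.2) q.2 = 0} := by
    refine IsClosed.inter (isClosed_eq ?_ continuous_const) (isClosed_eq ?_ continuous_const)
    · fun_prop
    · fun_prop
  refine Topology.IsInducing.subtypeVal.isCompact_iff.2 ?_
  refine Eq.mpr (congrArg IsCompact (Set.ext fun q => ⟨?_, ?_⟩)) (hprod.inter_right hcl)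
  · rintro ⟨⟨⟨m, n⟩, hm, hn⟩, hp, rfl⟩
    have h1 := bracketE_eq_zero_of_mem_momentCr h h𝔨 hμ hm hn hp
    have h2 := inner_le_of_mem_momentCr h h𝔨 hlam hreg hμ hm hn hp
    exact ⟨⟨⟨hm, h2⟩, hn⟩, (adL_apply _ _).trans h1.1,
      (adL_apply _ _).trans ((one_smul ℝ _).symm.trans h1.2)⟩
  · rintro ⟨⟨⟨hq1, -⟩, hq2⟩, h3, h4⟩
    exact ⟨⟨q, hq1, hq2⟩, mem_momentCr_of_bracketE_eq_zero h h𝔨 hlam hμ hq1 hq2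
      ((adL_apply _ _).symm.trans h3) ((adL_apply _ _).symm.trans h4), rfl⟩

end SemisimpleGroup

end AdjointOrbit

theorem mainTheorem8
    {E : Type*} [NormedAddCommGroup E] [NormedSpace ℝ E] [FiniteDimensional ℝ E] [CompleteSpace E]
    {G : Type*} [TopologicalSpace G] [ChartedSpace E G] [Group G] [LieGroup 𝓘(ℝ, E) ∞ G]
    [T2Space G] [ConnectedSpace G] [LieAlgebra.IsSemisimple ℝ (GroupLieAlgebra 𝓘(ℝ, E) G)]
    [Finite (Subgroup.center G)]
    (K : Subgroup G) (hK : AdjointOrbit.IsMaximalCompact K)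
    (𝔨 𝔭 : Submodule ℝ (GroupLieAlgebra 𝓘(ℝ, E) G))
    (h𝔨 : (𝔨 : Set (GroupLieAlgebra 𝓘(ℝ, E) G)) = AdjointOrbit.lieAlgebraOf E K)
    (h : AdjointOrbit.IsCartanDecomposition 𝔨 𝔭)
    (lam : GroupLieAlgebra 𝓘(ℝ, E) G) (hlam : lam ∈ 𝔨)
    (hreg : AdjointOrbit.IsRegularElliptic K lam) :
    (∀ μ ∈ 𝔨, IsCompact (AdjointOrbit.momentCr h K lam μ 1)) ∧
    (∀ r : ℝ, 0 ≤ r → ∃ c : ℝ, 0 < c ∧ ∀ μ ∈ 𝔨, AdjointOrbit.cartanNorm h μ ≤ r →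
      Subtype.val '' AdjointOrbit.momentCr h K lam μ 1 ⊆
        (AdjointOrbit.orbit (⊤ : Subgroup G) lam ∩ {ξ | AdjointOrbit.cartanNorm h ξ ≤ c}) ×ˢ
          AdjointOrbit.orbit K μ) ∧
    (∀ μ ∈ 𝔨, AdjointOrbit.CompactCrAssumption h K lam μ) := by
  refine ⟨fun μ hμ => AdjointOrbit.isCompact_momentCr_one h hK.prop h𝔨 hlam hreg hμ,
    fun r hr => ?_, fun μ hμ => ?_⟩
  · have hl : 0 ≤ AdjointOrbit.innerL h lam lam := h.inner_nonneg lam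
    -- The summand 1 only ensures that c(r) is positive.
    refine ⟨√(AdjointOrbit.innerL h lam lam + 2 * r ^ 2) + 1, by positivity, fun μ hμ hμr => ?_⟩
    rintro _ ⟨⟨⟨m, n⟩, hm, hn⟩, hp, rfl⟩
    refine ⟨⟨hm, ?_⟩, hn⟩
    have h1 := AdjointOrbit.inner_le_of_mem_momentCr h h𝔨 hlam hreg hμ hm hn hp
    have h2 : AdjointOrbit.innerL h μ μ ≤ r ^ 2 := by
      have h3 : AdjointOrbit.cartanNorm h μ ^ 2 ≤ r ^ 2 :=
        pow_le_pow_left₀ (Real.sqrt_nonneg _) hμr 2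
      rwa [h.cartanNorm_sq] at h3
    have h4 : AdjointOrbit.cartanNorm h m ≤ √(AdjointOrbit.innerL h lam lam + 2 * r ^ 2) :=
      Real.sqrt_le_sqrt (h1.trans (by linarith))
    exact h4.trans (by linarith)
  -- This is the bound at t = 1; it serves all t in [0, 1] because t² ≤ 1.
  · refine ⟨_, fun Y hY => hY.1, AdjointOrbit.isCompact_orbit_inter h hlam
      (AdjointOrbit.innerL h lam lam + 2 * AdjointOrbit.innerL h μ μ), fun t ht => ?_⟩
    rintro _ ⟨⟨⟨m, n⟩, hm, hn⟩, hp, rfl⟩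
    refine ⟨⟨hm, ?_⟩, hn⟩
    have h1 := AdjointOrbit.inner_le_of_mem_momentCr h h𝔨 hlam hreg hμ hm hn hp
    have h2 : 0 ≤ AdjointOrbit.innerL h μ μ := h.inner_nonneg μ
    have h3 : t ^ 2 ≤ 1 := pow_le_one₀ ht.1 ht.2
    exact h1.trans (by nlinarith)
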